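/- Consider the isosceles Schwarzschild problem: two equal point masses $M$ placed symmetrically about the origin of the horizontal plane and a third mass $m$ on the vertical axis. With $R>0$ the distance between the equal masses, $z$ the height of $m$, and $C\in\mathbb R$ the angular momentum, the motion is governed by Hamilton's equations of the reduced Hamiltonian on $\{R>0\}\subset\mathbb R^4$ $$H_C(R,z,P_R,P_z)=\frac1M\Big(P_R^2+\frac{C^2}{R^2}\Big)+\frac{2M+m}{4Mm}P_z^2-\frac AR-\frac B{R^3}-\frac{4A_1}{\sqrt{R^2+4z^2}}-\frac{16B_1}{(R^2+4z^2)^{3/2}},$$ where $M,m,A,B,A_1,B_1>0$. Put $\mu=\frac{2M+m}{m}$ and assume $$\mu>1+\frac{A}{4A_1},\qquad \mu>1+\frac{B}{16B_1},\qquad (\mu-1)^{4/15}\Big(\frac{4A_1}{A}\Big)^{2/3}\neq\Big(\frac{16B_1}{B}\Big)^{2/5}.$$ Let $\mathbf x=(R,z)$, $\mathbf p=(P_R,P_z)$, $T=\mathrm{diag}\big(\frac M2,\frac{2Mm}{2M+m}\big)$, $r=\sqrt{\mathbf x^tT\mathbf x}$, $\mathbf s=\mathbf x/r$ (the geometric configuration,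 up to similarity), and define $v,\theta,u,w$ by $v=r^{3/2}(\mathbf s\cdot\mathbf p)$, $\mathbf s=\sqrt{T^{-1}}(\cos\theta,\sin\theta)^t$ with $|\theta|<\frac\pi2$, $r^{3/2}(T^{-1}\mathbf p-(\mathbf s\cdot\mathbf p)\mathbf s)=u\sqrt{T^{-1}}(-\sin\theta,\cos\theta)^t$, and $w=\frac{\cos^3\theta}{\sqrt{W(\theta)\cos^3\theta}}\,u$, where $$W(\theta)=\Big(\frac M2\Big)^{3/2}\Big(\frac B{\cos^3\theta}+\frac{16B_1}{(\cos^2\theta+\mu\sin^2\theta)^{3/2}}\Big).$$ Let $Q^*$ be the point $(r,v,\theta,w)=(0,-\sqrt{2W(0)},0,0)$. A motion *leads to triple collision* if it is defined on some interval $[0,t_1)$, $0<t_1<\infty$, and $(R,z)\to(0,0)$ as $t\to t_1^-$; its *limiting configuration* is $\lim_{t\to t_1^-}\mathbf s(t)$, if this exists. A *homographic solution* is a solution, on an open time interval, of the unreduced problem in Jacobi coordinates ($\mathbf r_1=(x_1,y_1,0)\ne\mathbf 0$ the vector between the equal masses, $\mathbf r_2=(0,0,z_2)$ that from their midpoint to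 $m$; its Hamiltonian is obtained from the above by replacing $P_R^2+C^2/R^2$ by $p_{x_1}^2+p_{y_1}^2$ and $(R,z)$ by $(|\mathbf r_1|,z_2)$) of the form $\mathbf r_1(t)=\varphi(t)\Omega(t)\mathbf a_1$, $\mathbf r_2(t)=\varphi(t)\mathbf a_2$, where $\varphi$ is a nowhere vanishing scalar function, $\Omega(t)$ is a rotation about the vertical axis, and $\mathbf a_1=(a_{1x},a_{1y},0)$, $\mathbf a_2=(0,0,a_{2z})$ are fixed and not both zero; its geometric configuration is $\mathbf s$ computed at $(R,z)=(|\mathbf r_1|,z_2)$. **Proposition.** For every $C\in\mathbb R$ and every $h\in\mathbb R$, the set of initial conditions on the energy level $\{R>0,\ H_C=h\}$ whose motion leads to triple collision with a limiting configuration that is the geometric configuration of a homographic solution is measurable and has positive three-dimensional Lebesgue measure (surface measure) on the energy level. This set consists exactly of the initial conditions of the orbits that tend to $Q^*$, that is, of the motions on some $[0,t_1)$, $0<t_1<\infty$, along which $(r,v,\theta,w)\to Q^*$ as $t\to t_1^-$. -/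

import Mathlib

open Filter Topology MeasureTheory

noncomputable section

namespace IsoscelesSchwarzschild

/-! ### Hamiltonian systems -/

/-- The phase space `ℝⁿ × ℝⁿ`, with its Euclidean structure: `x (Sum.inl i)` is the `i`-th position
coordinate and `x (Sum.inr i)` its conjugate momentum. -/
abbrev Phase (n : ℕ) : Type := EuclideanSpace ℝ (Fin n ⊕ Fin n)

/-- The partial derivative of `H` at `x` in the coordinate `j`. -/
def partialDeriv {n : ℕ} (H : Phase n → ℝ) (j : Fin n ⊕ Fin n) (x : Phase n) : ℝ :=
  fderiv ℝ H x (EuclideanSpace.single j 1)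

/-- The Hamiltonian vector field: `q̇ᵢ = ∂H/∂pᵢ`, `ṗᵢ = -∂H/∂qᵢ`. -/
def hamiltonianField {n : ℕ} (H : Phase n → ℝ) (x : Phase n) : Phase n :=
  WithLp.toLp 2 (Sum.elim (fun i => partialDeriv H (Sum.inr i) x)
    (fun i => -partialDeriv H (Sum.inl i) x))

/-- `γ` solves Hamilton's equations of `H` on the set of times `J`. -/
def IsHamiltonianSolutionOn {n : ℕ} (H : Phase n → ℝ) (γ : ℝ → Phase n) (J : Set ℝ) : Prop :=
  IsIntegralCurveOn γ (fun _ => hamiltonianField H) J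

/-! ### The isosceles Schwarzschild problem -/

/-- The six external parameters: two masses `M`, a third mass `m`, and the coefficients of the
Schwarzschild potentials between the equal masses (`A`, `B`) and between each of them and the third
mass (`A₁`, `B₁`). -/
structure Params where
  M : ℝ
  m : ℝ
  A : ℝ
  B : ℝ
  A₁ : ℝ
  B₁ : ℝ
  M_pos : 0 < M
  m_pos : 0 < m
  A_pos : 0 < A
  B_pos : 0 < B
  A₁_pos : 0 < A₁
  B₁_pos : 0 < B₁

namespace Params

variable (p : Params)

/-- `μ = (2M + m) / m`. -/
def μ : ℝ := (2 * p.M + p.m) / p.m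

/-- The potential, where `R` is the distance between the equal masses and `z` the height of the
third mass. -/
def potential (R z : ℝ) : ℝ :=
  -p.A / R - p.B / R ^ 3 - 4 * p.A₁ / √(R ^ 2 + 4 * z ^ 2) - 16 * p.B₁ / √(R ^ 2 + 4 * z ^ 2) ^ 3

/-- The Hamiltonian in Jacobi coordinates `𝐫₁ = (x₁, y₁, 0)`, `𝐫₂ = (0, 0, z₂)`; the position
coordinates are `0 ↦ x₁`, `1 ↦ y₁`, `2 ↦ z₂`. -/
def hamiltonian (x : Phase 3) : ℝ :=
  1 / p.M * (x (Sum.inr 0) ^ 2 + x (Sum.inr 1) ^ 2)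
    + (2 * p.M + p.m) / (4 * p.M * p.m) * x (Sum.inr 2) ^ 2
    + p.potential √(x (Sum.inl 0) ^ 2 + x (Sum.inl 1) ^ 2) (x (Sum.inl 2))

/-- The reduced Hamiltonian at angular momentum `C`; the position coordinates are `0 ↦ R`,
`1 ↦ z`. -/
def reducedHamiltonian (C : ℝ) (x : Phase 2) : ℝ :=
  1 / p.M * (x (Sum.inr 0) ^ 2 + C ^ 2 / x (Sum.inl 0) ^ 2)
    + (2 * p.M + p.m) / (4 * p.M * p.m) * x (Sum.inr 1) ^ 2
    + p.potential (x (Sum.inl 0)) (x (Sum.inl 1))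

/-- The energy level `h` of the reduced system at angular momentum `C`. -/
def energyLevel (C h : ℝ) : Set (Phase 2) :=
  {x | 0 < x (Sum.inl 0) ∧ p.reducedHamiltonian C x = h}

/-- `γ` is a motion of the reduced system on the time interval `[0, t₁)`. -/
def IsMotion (C : ℝ) (γ : ℝ → Phase 2) (t₁ : ℝ) : Prop :=
  IsHamiltonianSolutionOn (p.reducedHamiltonian C) γ (Set.Ico 0 t₁) ∧
    ∀ t ∈ Set.Ico 0 t₁, 0 < γ t (Sum.inl 0)

/-! ### McGehee coordinates -/

/-- The first diagonal entry of the mass matrix `T`. -/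
def T₁ : ℝ := p.M / 2

/-- The second diagonal entry of the mass matrix `T`. -/
def T₂ : ℝ := 2 * p.M * p.m / (2 * p.M + p.m)

/-- The size `r = √(𝐱ᵗ T 𝐱)` of the configuration `𝐱 = (R, z)`. -/
def size (R z : ℝ) : ℝ := √(p.T₁ * R ^ 2 + p.T₂ * z ^ 2)

/-- The geometric configuration (similarity class) of the three masses at `(R, z) ≠ 0`,
represented by the normalized vector `𝐬 = 𝐱 / r`. -/
def shape (R z : ℝ) : ℝ × ℝ := (R / p.size R z, z / p.size R z)

/-- The shape function `W(θ)` of the inverse cubic part of the potential. -/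
def W (θ : ℝ) : ℝ :=
  (p.M / 2) ^ (3 / 2 : ℝ) * (p.B / Real.cos θ ^ 3
    + 16 * p.B₁ / (Real.cos θ ^ 2 + p.μ * Real.sin θ ^ 2) ^ (3 / 2 : ℝ))

/-- `r` at a phase point. -/
def r (x : Phase 2) : ℝ := p.size (x (Sum.inl 0)) (x (Sum.inl 1))

/-- `𝐬 · 𝐩` at a phase point. -/
def sDotP (x : Phase 2) : ℝ :=
  (p.shape (x (Sum.inl 0)) (x (Sum.inl 1))).1 * x (Sum.inr 0)
    + (p.shape (x (Sum.inl 0)) (x (Sum.inl 1))).2 * x (Sum.inr 1)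

/-- `v = r^{3/2} (𝐬 · 𝐩)`. -/
def v (x : Phase 2) : ℝ := p.r x ^ (3 / 2 : ℝ) * p.sDotP x

/-- The angle `θ ∈ (-π/2, π/2)` with `𝐬 = √(T⁻¹) (cos θ, sin θ)ᵗ`, for `R > 0`. -/
def θ (x : Phase 2) : ℝ :=
  Real.arctan ((√p.T₂ * x (Sum.inl 1)) / (√p.T₁ * x (Sum.inl 0)))

/-- The number `u` with `𝐮 = u √(T⁻¹) (-sin θ, cos θ)ᵗ`, where
`𝐮 = r^{3/2} (T⁻¹ 𝐩 - (𝐬 · 𝐩) 𝐬)`; that is, the scalar product of `√T 𝐮` with the unit vector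
`(-sin θ, cos θ)`. -/
def u (x : Phase 2) : ℝ :=
  let u₁ := p.r x ^ (3 / 2 : ℝ) *
    (x (Sum.inr 0) / p.T₁ - p.sDotP x * (p.shape (x (Sum.inl 0)) (x (Sum.inl 1))).1)
  let u₂ := p.r x ^ (3 / 2 : ℝ) *
    (x (Sum.inr 1) / p.T₂ - p.sDotP x * (p.shape (x (Sum.inl 0)) (x (Sum.inl 1))).2)
  Real.cos (p.θ x) * (√p.T₂ * u₂) - Real.sin (p.θ x) * (√p.T₁ * u₁)

/-- `w = (cos³ θ / √(U(θ))) u`, where `U(θ) = W(θ) cos³ θ`. -/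
def w (x : Phase 2) : ℝ :=
  Real.cos (p.θ x) ^ 3 / √(p.W (p.θ x) * Real.cos (p.θ x) ^ 3) * p.u x

/-- The coordinates `(r, v, θ, w)`. -/
def mcGehee (x : Phase 2) : ℝ × ℝ × ℝ × ℝ := (p.r x, p.v x, p.θ x, p.w x)

/-- The equilibrium `Q* = (0, -√(2 W(0)), 0, 0)` on the triple collision manifold. -/
def QStar : ℝ × ℝ × ℝ × ℝ := (0, -√(2 * p.W 0), 0, 0)

/-! ### Homographic solutions -/

/-- `γ` is a homographic solution of the (unreduced) isosceles problem on the set of times `J`: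
`𝐫₁(t) = φ(t) Ω(t) 𝐚₁` and `𝐫₂(t) = φ(t) 𝐚₂`, with `φ` nowhere zero, `Ω(t)` the rotation by the
angle `ψ(t)` about the vertical axis, `𝐚₁ = (a₁, a₂, 0)`, `𝐚₂ = (0, 0, a₃)` fixed and not both
zero. -/
def IsHomographicOn (γ : ℝ → Phase 3) (J : Set ℝ) : Prop :=
  IsHamiltonianSolutionOn p.hamiltonian γ J ∧
  (∀ t ∈ J, γ t (Sum.inl 0) ^ 2 + γ t (Sum.inl 1) ^ 2 ≠ 0) ∧
  ∃ (φ ψ : ℝ → ℝ) (a₁ a₂ a₃ : ℝ), (a₁, a₂, a₃) ≠ 0 ∧ ∀ t ∈ J,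
    φ t ≠ 0 ∧
    γ t (Sum.inl 0) = φ t * (Real.cos (ψ t) * a₁ - Real.sin (ψ t) * a₂) ∧
    γ t (Sum.inl 1) = φ t * (Real.sin (ψ t) * a₁ + Real.cos (ψ t) * a₂) ∧
    γ t (Sum.inl 2) = φ t * a₃

/-- `s` is the geometric configuration of a homographic solution (defined on some open time
interval). -/
def IsHomographicShape (s : ℝ × ℝ) : Prop :=
  ∃ (γ : ℝ → Phase 3) (a b : ℝ), p.IsHomographicOn γ (Set.Ioo a b) ∧ ∃ t ∈ Set.Ioo a b,
    p.shape √(γ t (Sum.inl 0) ^ 2 + γ t (Sum.inl 1) ^ 2) (γ t (Sum.inl 2)) = s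

/-! ### Initial conditions leading to triple collision -/

/-- The motion `γ` ends in triple collision (`R = z = 0`) at time `t₁`. -/
def EndsInTripleCollision (γ : ℝ → Phase 2) (t₁ : ℝ) : Prop :=
  Tendsto (fun t => (γ t (Sum.inl 0), γ t (Sum.inl 1))) (𝓝[<] t₁) (𝓝 (0, 0))

/-- The geometric configuration along `γ` tends to `s` as `t → t₁`. -/
def HasLimitingShape (γ : ℝ → Phase 2) (t₁ : ℝ) (s : ℝ × ℝ) : Prop :=
  Tendsto (fun t => p.shape (γ t (Sum.inl 0)) (γ t (Sum.inl 1))) (𝓝[<] t₁) (𝓝 s)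

/-- The initial conditions of energy `h` and angular momentum `C` whose motion leads to triple
collision with a limiting geometric configuration that is the one of a homographic solution. -/
def homographicCollisionSet (C h : ℝ) : Set (Phase 2) :=
  {x | x ∈ p.energyLevel C h ∧ ∃ (γ : ℝ → Phase 2) (t₁ : ℝ), 0 < t₁ ∧ γ 0 = x ∧
    p.IsMotion C γ t₁ ∧ EndsInTripleCollision γ t₁ ∧
    ∃ s, p.IsHomographicShape s ∧ p.HasLimitingShape γ t₁ s}

/-- The initial conditions of energy `h` and angular momentum `C` whose orbit tends to `Q*`. -/
def basinQStar (C h : ℝ) : Set (Phase 2) :=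
  {x | x ∈ p.energyLevel C h ∧ ∃ (γ : ℝ → Phase 2) (t₁ : ℝ), 0 < t₁ ∧ γ 0 = x ∧
    p.IsMotion C γ t₁ ∧ Tendsto (fun t => p.mcGehee (γ t)) (𝓝[<] t₁) (𝓝 p.QStar)}

end Params

end IsoscelesSchwarzschild

end

/-! The only homographic shape is the planar one, z = 0. It is realised by uniform circular motion.
Off the plane, conservation of angular momentum would make the shape critical for the Newtonian and
for the inverse-cube part of the potential at once, which the non-coincidence condition excludes
(`IsHomographicOn.z_eq_zero`). The set in question therefore consists of the planar collisions: R →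
0 and q = z/R → 0.

Use the scaled time dτ = dt / R^{5/2}, with ν = R^{3/2} Ṙ and η = dq/dτ. The equations become R' =
νR, q' = η, η' = νη/2 − κ(q, R) q. The energy integral multiplied by R³ stays regular at R = 0,
where h and C drop out because the inverse-cube terms dominate. Along a planar collision q → 0 while
η' is bounded, so η → 0 (`tendsto_zero_of_slow_variation`). The energy relation then gives ν² → c²,
and R → 0 selects ν → −c. In McGehee coordinates this is convergence to Q*. Conversely, r → 0 and θ
→ 0 already force R → 0 and q → 0 (`IsMotion.tendsto_QStar_iff`). This proves the equality of the
two sets.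

Q* attracts: the condition on B makes κ(0, 0) positive, and νη/2 is friction as long as ν is close
to −c. A quadratic Lyapunov function with a small cross term yields a trapping region, in which R
decreases to 0 in finite time and q → 0 (`exists_trap`). Every planar collision orbit enters this
region, so by continuous dependence the set is relatively open in the energy level
(`eventually_mem_planarCollisionSet`), hence measurable. Its measure is positive because its image
under the 1-Lipschitz projection to (R, z, P_z) contains a neighbourhood of a point. -/

/-! ### Autonomous differential equations -/

section ODE

open Set
open scoped NNReal

variable {E : Type*} [NormedAddCommGroup E] [NormedSpace ℝ E]

/-- A `C¹` vector field on an open set agrees, near a compact subset, with a bounded and globally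
Lipschitz one. -/
theorem exists_lipschitzWith_eqOn_nhds [FiniteDimensional ℝ E] {X : E → E} {U K : Set E}
    (hU : IsOpen U) (hX : ContDiffOn ℝ 1 X U) (hK : IsCompact K) (hKU : K ⊆ U) :
    ∃ (Y : E → E) (V : Set E) (L B : ℝ≥0), IsOpen V ∧ K ⊆ V ∧ V ⊆ U ∧ LipschitzWith L Y ∧
      (∀ x, ‖Y x‖ ≤ B) ∧ EqOn Y X V := by
  obtain ⟨K', hK', hKK', hK'U⟩ := exists_compact_between hK hU hKU
  obtain ⟨f, hf1, hf0, -⟩ := exists_contMDiffMap_one_nhds_of_subset_interior (n := 1)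
    (modelWithCornersSelf ℝ E) hK.isClosed hKK'
  have hfs : ContDiff ℝ 1 f := f.contMDiff.contDiff
  obtain ⟨V, hV1, hVo, hKV⟩ := mem_nhdsSet_iff_exists.1 hf1 |>.imp fun V hV =>
    (⟨hV.2.2, hV.1, hV.2.1⟩ : _ ∧ _ ∧ _)
  have hsupp : Function.support (fun x => f x • X x) ⊆ K' := fun x hx => by
    by_contra h
    exact hx (by simp [hf0 x h])
  have htsupp : tsupport (fun x => f x • X x) ⊆ K' := closure_minimal hsupp hK'.isClosed
  have hcs : HasCompactSupport (fun x => f x • X x) := hK'.of_isClosed_subset (isClosed_tsupport _) htsupp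
  have hcd : ContDiff ℝ 1 (fun x => f x • X x) := by
    refine contDiff_iff_contDiffAt.2 fun x => ?_
    by_cases hx : x ∈ U
    · exact hfs.contDiffAt.smul (hX.contDiffAt (hU.mem_nhds hx))
    · have : x ∉ tsupport (fun x => f x • X x) := fun h => hx (hK'U (htsupp h))
      exact (contDiffAt_const (c := (0 : E))).congr_of_eventuallyEq
        (notMem_tsupport_iff_eventuallyEq.1 this)
  obtain ⟨L, hL⟩ := hcd.lipschitzWith_of_hasCompactSupport hcs one_ne_zero
  obtain ⟨B, hB⟩ := hcs.exists_bound_of_continuous hcd.continuous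
  refine ⟨fun x => f x • X x, V ∩ U, L, B.toNNReal, hVo.inter hU, subset_inter hKV hKU,
    inter_subset_right, hL, fun x => (hB x).trans (Real.le_coe_toNNReal B), fun x hx => ?_⟩
  have : f x = 1 := hV1 hx.1
  simp [this]

/-- A field bounded by B cannot carry a curve out of the ball of radius B T within time T, so a
single application of Picard–Lindelöf covers the whole interval. -/
theorem exists_hasDerivWithinAt_Icc_of_lipschitzWith [CompleteSpace E] {Y : E → E} {L B : ℝ≥0}
    (hL : LipschitzWith L Y) (hB : ∀ x, ‖Y x‖ ≤ B) (x : E) {T : ℝ} (hT : 0 ≤ T) :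
    ∃ γ : ℝ → E, γ 0 = x ∧ IsIntegralCurveOn γ (fun _ => Y) (Icc 0 T) := by
  have : IsPicardLindelof (fun _ => Y) (tmin := 0) (tmax := T) ⟨0, by simp [hT]⟩ x
      (B * T.toNNReal) 0 B L := by
    refine .of_time_independent (fun y _ => hB y) hL.lipschitzOnWith ?_
    simp [hT]
  exact this.exists_eq_forall_mem_Icc_hasDerivWithinAt₀

theorem hasDerivWithinAt_Ici_of_Ico {γ : ℝ → E} {v : E} {a b t : ℝ}
    (h : HasDerivWithinAt γ v (Ico a b) t) (ht : t ∈ Ico a b) : HasDerivWithinAt γ v (Ici t) t :=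
  (h.mono (Ico_subset_Ico_left ht.1)).mono_of_mem_nhdsWithin (Ico_mem_nhdsGE ht.2)

theorem dist_le_of_isIntegralCurveOn_Ico {Y : E → E} {L : ℝ≥0} (hL : LipschitzWith L Y)
    {γ₁ γ₂ : ℝ → E} {b t δ : ℝ} (h₁ : IsIntegralCurveOn γ₁ (fun _ => Y) (Ico 0 b))
    (h₂ : IsIntegralCurveOn γ₂ (fun _ => Y) (Ico 0 b)) (ht : t ∈ Ico 0 b)
    (h0 : dist (γ₁ 0) (γ₂ 0) ≤ δ) : dist (γ₁ t) (γ₂ t) ≤ δ * Real.exp (L * t) := by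
  have hsub : Icc 0 t ⊆ Ico 0 b := fun s hs => ⟨hs.1, hs.2.trans_lt ht.2⟩
  have hsub' : Ico 0 t ⊆ Ico 0 b := Ico_subset_Ico_right ht.2.le
  simpa using dist_le_of_trajectories_ODE (v := fun _ => Y) (fun _ => hL)
    (h₁.continuousOn.mono hsub) (fun s hs => hasDerivWithinAt_Ici_of_Ico (h₁ s (hsub' hs)) (hsub' hs))
    (h₂.continuousOn.mono hsub) (fun s hs => hasDerivWithinAt_Ici_of_Ico (h₂ s (hsub' hs)) (hsub' hs))
    h0 t ⟨ht.1, le_rfl⟩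

theorem IsIntegralCurveOn.congr_field {X Y : E → E} {γ : ℝ → E} {J : Set ℝ} {V : Set E}
    (h : IsIntegralCurveOn γ (fun _ => X) J) (hγ : MapsTo γ J V) (hXY : EqOn X Y V) :
    IsIntegralCurveOn γ (fun _ => Y) J := fun t ht => by
  simpa only [hXY (hγ ht)] using h t ht

/-- On [0, s] with s < b both curves trace compact subsets of U. Near their union X may be replaced
by a globally Lipschitz field, and Grönwall with initial distance 0 applies. -/
theorem IsIntegralCurveOn.eqOn_Ico [FiniteDimensional ℝ E] {X : E → E} {U : Set E}
    (hU : IsOpen U) (hX : ContDiffOn ℝ 1 X U) {γ₁ γ₂ : ℝ → E} {b : ℝ}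
    (h₁ : IsIntegralCurveOn γ₁ (fun _ => X) (Ico 0 b)) (m₁ : MapsTo γ₁ (Ico 0 b) U)
    (h₂ : IsIntegralCurveOn γ₂ (fun _ => X) (Ico 0 b)) (m₂ : MapsTo γ₂ (Ico 0 b) U)
    (h0 : γ₁ 0 = γ₂ 0) : EqOn γ₁ γ₂ (Ico 0 b) := by
  intro t ht
  obtain ⟨s, hts, hsb⟩ := exists_between ht.2
  have hsub : Icc 0 s ⊆ Ico 0 b := fun r hr => ⟨hr.1, hr.2.trans_lt hsb⟩
  have hsub' : Ico 0 s ⊆ Icc 0 s := Ico_subset_Icc_self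
  obtain ⟨Y, V, L, B, -, hKV, -, hL, -, hYX⟩ := exists_lipschitzWith_eqOn_nhds hU hX
    ((isCompact_Icc.image_of_continuousOn (h₁.continuousOn.mono hsub)).union
      (isCompact_Icc.image_of_continuousOn (h₂.continuousOn.mono hsub)))
    (union_subset (image_subset_iff.2 (m₁.mono_left hsub)) (image_subset_iff.2 (m₂.mono_left hsub)))
  have e₁ : IsIntegralCurveOn γ₁ (fun _ => Y) (Ico 0 s) :=
    (h₁.mono (hsub'.trans hsub)).congr_field
      (fun r hr => hKV (Or.inl (mem_image_of_mem _ (hsub' hr)))) hYX.symm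
  have e₂ : IsIntegralCurveOn γ₂ (fun _ => Y) (Ico 0 s) :=
    (h₂.mono (hsub'.trans hsub)).congr_field
      (fun r hr => hKV (Or.inr (mem_image_of_mem _ (hsub' hr)))) hYX.symm
  have := dist_le_of_isIntegralCurveOn_Ico hL e₁ e₂ ⟨ht.1, hts⟩ (δ := 0) (by simp [h0])
  exact dist_le_zero.1 (by simpa using this)

theorem IsIntegralCurveOn.of_forall_Ico {Y : E → E} {γ : ℝ → E} {b : ℝ}
    (h : ∀ t ∈ Ico 0 b, ∃ c > t, IsIntegralCurveOn γ (fun _ => Y) (Ico 0 c)) :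
    IsIntegralCurveOn γ (fun _ => Y) (Ico 0 b) := by
  intro t ht
  obtain ⟨c, htc, hc⟩ := h t ht
  refine (hc t ⟨ht.1, htc⟩).mono_of_mem_nhdsWithin ?_
  exact mem_of_superset (inter_mem_nhdsWithin _ (Iio_mem_nhds htc)) fun s hs => ⟨hs.1.1, hs.2⟩

/-- A solution through a point of a compact set stays in `U` beyond the time up to which it stays
in the compact set. -/
theorem exists_isIntegralCurveOn_extension [FiniteDimensional ℝ E] {X : E → E} {U K : Set E}
    (hU : IsOpen U) (hX : ContDiffOn ℝ 1 X U) (hK : IsCompact K) (hKU : K ⊆ U) {x : E} {b : ℝ}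
    (hb : 0 ≤ b) (hxK : x ∈ K) {γ : ℝ → E} (h0 : γ 0 = x)
    (hγ : IsIntegralCurveOn γ (fun _ => X) (Ico 0 b)) (hm : MapsTo γ (Ico 0 b) K) :
    ∃ (c : ℝ) (γ' : ℝ → E), b < c ∧ γ' 0 = x ∧ IsIntegralCurveOn γ' (fun _ => X) (Ico 0 c) ∧
      MapsTo γ' (Ico 0 c) U := by
  obtain ⟨Y, V, L, B, hVo, hKV, hVU, hL, hB, hYX⟩ := exists_lipschitzWith_eqOn_nhds hU hX hK hKU
  obtain ⟨γ', h0', hγ'⟩ := exists_hasDerivWithinAt_Icc_of_lipschitzWith hL hB x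
    (T := b + 1) (by linarith)
  have hsub : Ico 0 b ⊆ Icc 0 (b + 1) := fun s hs => ⟨hs.1, by linarith [hs.2]⟩
  have heq : EqOn γ' γ (Ico 0 b) := fun t ht => by
    have := dist_le_of_isIntegralCurveOn_Ico hL (hγ'.mono hsub)
      (hγ.congr_field hm (hYX.symm.mono hKV)) ht (δ := 0) (by simp [h0, h0'])
    exact dist_le_zero.1 (by simpa using this)
  -- The case b = 0 is kept so that the lemma also gives local existence. For b > 0, the endpoint is
  -- a limit of points of the closed set K.
  have hbK : γ' b ∈ K := by
    rcases hb.eq_or_lt with rfl | hb'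
    · rwa [h0']
    · have hc : ContinuousWithinAt γ' (Ico 0 b) b :=
        (hγ'.continuousOn b ⟨hb, by linarith⟩).mono hsub
      refine hK.isClosed.closure_subset (hc.mem_closure ?_ fun t ht => ?_)
      · rw [closure_Ico hb'.ne]; exact ⟨hb, le_rfl⟩
      · rw [heq ht]; exact hm ht
  have hnb : ∀ᶠ t in 𝓝[Icc 0 (b + 1)] b, γ' t ∈ V :=
    hγ'.continuousOn b ⟨hb, by linarith⟩ (hVo.mem_nhds (hKV hbK))
  obtain ⟨ε, hε, hεV⟩ := Metric.mem_nhdsWithin_iff.1 hnb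
  have hmV : MapsTo γ' (Ico 0 (b + min ε 1)) V := by
    intro t ht
    rcases lt_or_ge t b with h | h
    · rw [heq ⟨ht.1, h⟩]; exact hKV (hm ⟨ht.1, h⟩)
    · refine hεV ⟨?_, ht.1, ?_⟩
      · rw [Metric.mem_ball, Real.dist_eq, abs_of_nonneg (by linarith)]
        linarith [ht.2, min_le_left ε 1]
      · linarith [ht.2, min_le_right ε 1]
  refine ⟨b + min ε 1, γ', by simp [hε], h0', ?_, hmV.mono_right hVU⟩
  exact (hγ'.mono fun t ht => ⟨ht.1, by linarith [ht.2, min_le_right ε 1]⟩).congr_field hmV hYX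

/-- If all solutions in `U` with initial value `x` have a bounded lifetime, then there is a maximal
one, and it leaves every compact subset of `U`. -/
theorem exists_maximal_isIntegralCurveOn [FiniteDimensional ℝ E] {X : E → E} {U : Set E}
    (hU : IsOpen U) (hX : ContDiffOn ℝ 1 X U) {x : E} (hx : x ∈ U) {T : ℝ}
    (hT : ∀ (γ : ℝ → E) (b : ℝ), 0 < b → γ 0 = x → IsIntegralCurveOn γ (fun _ => X) (Ico 0 b) →
      MapsTo γ (Ico 0 b) U → b ≤ T) :
    ∃ (γ : ℝ → E) (t₁ : ℝ), 0 < t₁ ∧ γ 0 = x ∧ IsIntegralCurveOn γ (fun _ => X) (Ico 0 t₁) ∧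
      MapsTo γ (Ico 0 t₁) U ∧ ∀ K, IsCompact K → K ⊆ U → ¬ MapsTo γ (Ico 0 t₁) K := by
  set S : Set ℝ := {b | 0 < b ∧ ∃ γ : ℝ → E, γ 0 = x ∧ IsIntegralCurveOn γ (fun _ => X) (Ico 0 b) ∧
    MapsTo γ (Ico 0 b) U} with hS
  have hSne : S.Nonempty := by
    -- Local existence: extend the empty solution on [0, 0), with K = {x}.
    obtain ⟨c, γ, hc, h0, h1, h2⟩ := exists_isIntegralCurveOn_extension hU hX
      (isCompact_singleton (x := x)) (by simpa using hx) le_rfl rfl (γ := fun _ => x) rfl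
      (fun t ht => by simp at ht) (fun t ht => by simp at ht)
    exact ⟨c, hc, γ, h0, h1, h2⟩
  have hSbd : BddAbove S := ⟨T, fun b hb => by
    obtain ⟨hb0, γ, h0, h1, h2⟩ := hb
    exact hT γ b hb0 h0 h1 h2⟩
  set t₁ := sSup S
  have ht₁ : 0 < t₁ := by
    obtain ⟨b, hb⟩ := hSne
    exact hb.1.trans_le (le_csSup hSbd hb)
  -- For each t < t₁ choose a solution living beyond t. By uniqueness the diagonal s ↦ g s s agrees
  -- with every chosen solution where both are defined, which glues them together.
  have hex : ∀ t, ∃ (b : ℝ) (γ : ℝ → E), t < t₁ → t < b ∧ γ 0 = x ∧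
      IsIntegralCurveOn γ (fun _ => X) (Ico 0 b) ∧ MapsTo γ (Ico 0 b) U := fun t => by
    by_cases ht : t < t₁
    · obtain ⟨b, ⟨-, γ, h⟩, htb⟩ := exists_lt_of_lt_csSup hSne ht
      exact ⟨b, γ, fun _ => ⟨htb, h⟩⟩
    · exact ⟨0, fun _ => x, fun h => absurd h ht⟩
  choose b g hg using hex
  have key : ∀ t ∈ Ico 0 t₁, EqOn (fun s => g s s) (g t) (Ico 0 (b t) ∩ Iio t₁) := by
    rintro t ht s ⟨hs, hs1⟩
    obtain ⟨h1, h2, h3, h4⟩ := hg t ht.2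
    obtain ⟨k1, k2, k3, k4⟩ := hg s hs1
    refine IsIntegralCurveOn.eqOn_Ico hU hX (b := min (b s) (b t))
      (k3.mono (Ico_subset_Ico_right (min_le_left _ _)))
      (k4.mono_left (Ico_subset_Ico_right (min_le_left _ _)))
      (h3.mono (Ico_subset_Ico_right (min_le_right _ _)))
      (h4.mono_left (Ico_subset_Ico_right (min_le_right _ _))) (k2.trans h2.symm)
      ⟨hs.1, lt_min k1 hs.2⟩
  have hcurve : IsIntegralCurveOn (fun s => g s s) (fun _ => X) (Ico 0 t₁) := by
    refine IsIntegralCurveOn.of_forall_Ico fun t ht => ⟨min (b t) t₁, lt_min (hg t ht.2).1 ht.2, ?_⟩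
    intro s hs
    have hsub : Ico 0 (min (b t) t₁) ⊆ Ico 0 (b t) ∩ Iio t₁ :=
      fun r hr => ⟨⟨hr.1, hr.2.trans_le (min_le_left _ _)⟩, hr.2.trans_le (min_le_right _ _)⟩
    have h := ((hg t ht.2).2.2.1 s (hsub hs).1).mono (hsub.trans inter_subset_left)
    have he := (key t ht).mono hsub
    rw [← he hs] at h
    exact h.congr he (he hs)
  have hmaps : MapsTo (fun s => g s s) (Ico 0 t₁) U := fun s hs =>
    (hg s hs.2).2.2.2 ⟨hs.1, (hg s hs.2).1⟩
  refine ⟨fun s => g s s, t₁, ht₁, (hg 0 ht₁).2.1, hcurve, hmaps, fun K hK hKU hm => ?_⟩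
  obtain ⟨c, γ', hc, h0, h1, h2⟩ := exists_isIntegralCurveOn_extension hU hX hK hKU ht₁.le
    (by simpa [(hg 0 ht₁).2.1] using hm ⟨le_rfl, ht₁⟩) (γ := fun s => g s s)
    (hg 0 ht₁).2.1 hcurve hm
  exact absurd (le_csSup hSbd (show c ∈ S from ⟨ht₁.trans hc, γ', h0, h1, h2⟩)) (not_le.2 hc)

/-- Continuous dependence on the initial value. -/
theorem eventually_exists_isIntegralCurveOn_Icc [FiniteDimensional ℝ E] {X : E → E} {U : Set E}
    (hU : IsOpen U) (hX : ContDiffOn ℝ 1 X U) {γ : ℝ → E} {b t₀ : ℝ}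
    (h : IsIntegralCurveOn γ (fun _ => X) (Ico 0 b)) (hm : MapsTo γ (Ico 0 b) U)
    (ht₀ : t₀ ∈ Ico 0 b) {N : Set E} (hN : N ∈ 𝓝 (γ t₀)) :
    ∀ᶠ x in 𝓝 (γ 0), ∃ γ' : ℝ → E, γ' 0 = x ∧ IsIntegralCurveOn γ' (fun _ => X) (Icc 0 t₀) ∧
      MapsTo γ' (Icc 0 t₀) U ∧ γ' t₀ ∈ N := by
  have hsub : Icc 0 t₀ ⊆ Ico 0 b := fun r hr => ⟨hr.1, hr.2.trans_lt ht₀.2⟩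
  have hK : IsCompact (γ '' Icc 0 t₀) :=
    isCompact_Icc.image_of_continuousOn (h.continuousOn.mono hsub)
  obtain ⟨Y, V, L, B, hVo, hKV, hVU, hL, hB, hYX⟩ := exists_lipschitzWith_eqOn_nhds hU hX hK
    (image_subset_iff.2 (hm.mono_left hsub))
  obtain ⟨ε, hε, hεV⟩ := hK.exists_thickening_subset_open hVo hKV
  obtain ⟨ε', hε', hεN⟩ := Metric.mem_nhds_iff.1 hN
  have hγY : IsIntegralCurveOn γ (fun _ => Y) (Icc 0 t₀) :=
    (h.mono hsub).congr_field (fun t ht => hKV (mem_image_of_mem _ ht)) hYX.symm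
  set c := Real.exp (L * t₀)
  have hc : 0 < c := Real.exp_pos _
  -- Dividing by c compensates the largest Grönwall factor on [0, t₀].
  refine Metric.eventually_nhds_iff.2 ⟨min ε ε' / c, by positivity, fun x hx => ?_⟩
  obtain ⟨γ', h0', hγ'⟩ := exists_hasDerivWithinAt_Icc_of_lipschitzWith hL hB x ht₀.1
  have hd : ∀ t ∈ Icc 0 t₀, dist (γ' t) (γ t) < min ε ε' := fun t ht => by
    have key := dist_le_of_trajectories_ODE (v := fun _ => Y) (a := 0) (b := t₀) (fun _ => hL)
      hγ'.continuousOn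
      (fun s hs => hasDerivWithinAt_Ici_of_Ico ((hγ' s ⟨hs.1, hs.2.le⟩).mono Ico_subset_Icc_self) hs)
      hγY.continuousOn
      (fun s hs => hasDerivWithinAt_Ici_of_Ico ((hγY s ⟨hs.1, hs.2.le⟩).mono Ico_subset_Icc_self) hs)
      le_rfl t ht
    rw [h0', sub_zero] at key
    have h1 : Real.exp (L * t) ≤ c :=
      Real.exp_le_exp.2 (mul_le_mul_of_nonneg_left ht.2 L.2)
    calc dist (γ' t) (γ t) ≤ dist x (γ 0) * Real.exp (L * t) := key
      _ ≤ dist x (γ 0) * c := by gcongr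
      _ < min ε ε' := (lt_div_iff₀ hc).1 hx
  have hmV : MapsTo γ' (Icc 0 t₀) V := fun t ht => hεV (Metric.mem_thickening_iff.2
    ⟨γ t, mem_image_of_mem _ ht, (hd t ht).trans_le (min_le_left _ _)⟩)
  exact ⟨γ', h0', hγ'.congr_field hmV hYX, hmV.mono_right hVU,
    hεN ((hd t₀ ⟨ht₀.1, le_rfl⟩).trans_le (min_le_right _ _))⟩

/-- The field is autonomous, so the shifted second curve is again a solution. At the junction both
one-sided derivatives equal X at the common point. -/
theorem IsIntegralCurveOn.concat {X : E → E} {γ₁ γ₂ : ℝ → E} {t₀ b : ℝ} (ht₀ : 0 ≤ t₀)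
    (h₁ : IsIntegralCurveOn γ₁ (fun _ => X) (Icc 0 t₀))
    (h₂ : IsIntegralCurveOn γ₂ (fun _ => X) (Ico 0 b)) (h : γ₂ 0 = γ₁ t₀) :
    IsIntegralCurveOn (fun t => if t ≤ t₀ then γ₁ t else γ₂ (t - t₀)) (fun _ => X)
      (Ico 0 (t₀ + b)) := by
  set γ : ℝ → E := fun t => if t ≤ t₀ then γ₁ t else γ₂ (t - t₀)
  have e₁ : EqOn γ γ₁ (Icc 0 t₀) := fun t ht => if_pos ht.2
  have e₂ : EqOn γ (fun t => γ₂ (t - t₀)) (Ico t₀ (t₀ + b)) := fun t ht => by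
    rcases ht.1.eq_or_lt with rfl | h'
    · simp [γ, h]
    · simp [γ, not_le.2 h']
  have d₁ : ∀ t ∈ Icc 0 t₀, HasDerivWithinAt γ (X (γ t)) (Icc 0 t₀) t := fun t ht => by
    rw [e₁ ht]; exact (h₁ t ht).congr e₁ (e₁ ht)
  have d₂ : ∀ t ∈ Ico t₀ (t₀ + b), HasDerivWithinAt γ (X (γ t)) (Ico t₀ (t₀ + b)) t :=
      fun t ht => by
    rw [e₂ ht]
    refine HasDerivWithinAt.congr ?_ e₂ (e₂ ht)
    have hst : t - t₀ ∈ Ico 0 b := ⟨by linarith [ht.1], by linarith [ht.2]⟩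
    have := (h₂ _ hst).scomp t (((hasDerivAt_id t).sub_const t₀).hasDerivWithinAt
      (s := Ico t₀ (t₀ + b))) (t' := Ico 0 b)
      (fun s hs => ⟨by simpa using hs.1, by simpa [sub_lt_iff_lt_add'] using hs.2⟩)
    simpa [Function.comp_def] using this
  intro t ht
  have hcov : Ico 0 (t₀ + b) ⊆ Icc 0 t₀ ∪ Ico t₀ (t₀ + b) := fun s hs => by
    rcases le_total s t₀ with h' | h'
    · exact Or.inl ⟨hs.1, h'⟩
    · exact Or.inr ⟨h', hs.2⟩
  rcases lt_trichotomy t t₀ with h' | rfl | h'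
  · refine (d₁ t ⟨ht.1, h'.le⟩).mono_of_mem_nhdsWithin ?_
    exact mem_of_superset (inter_mem_nhdsWithin _ (Iio_mem_nhds h'))
      fun s hs => ⟨hs.1.1, (show s < t₀ from hs.2).le⟩
  · exact ((d₁ t ⟨ht₀, le_rfl⟩).union (d₂ t ⟨le_rfl, ht.2⟩)).mono hcov
  · refine (d₂ t ⟨h'.le, ht.2⟩).mono_of_mem_nhdsWithin ?_
    exact mem_of_superset (inter_mem_nhdsWithin _ (Ioi_mem_nhds h'))
      fun s hs => ⟨(show t₀ < s from hs.2).le, hs.1.2⟩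

end ODE

namespace IsoscelesSchwarzschild

open Set

/-! ### Hamiltonian systems in coordinates -/

theorem partialDeriv_eq_of_hasDerivAt {n : ℕ} {H : Phase n → ℝ} {j : Fin n ⊕ Fin n} {x : Phase n}
    {d : ℝ} (hH : DifferentiableAt ℝ H x)
    (h : HasDerivAt (fun s : ℝ => H (x + s • EuclideanSpace.single j 1)) d 0) :
    partialDeriv H j x = d := by
  have h1 : HasLineDerivAt ℝ H (fderiv ℝ H x (EuclideanSpace.single j 1)) x
      (EuclideanSpace.single j 1) := hH.hasFDerivAt.hasLineDerivAt _
  exact HasDerivAt.unique h1 h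

/-- Antisymmetry: the contributions of each position coordinate and its conjugate momentum cancel.
-/
theorem fderiv_hamiltonianField {n : ℕ} (H : Phase n → ℝ) (x : Phase n) :
    fderiv ℝ H x (hamiltonianField H x) = 0 := by
  have h : hamiltonianField H x =
      ∑ j, hamiltonianField H x j • EuclideanSpace.single j (1 : ℝ) := by
    ext i
    rcases i with i | i <;> simp [Finset.sum_apply, Pi.single_apply]
  rw [h, map_sum, Fintype.sum_sum_type, ← Finset.sum_add_distrib]
  refine Finset.sum_eq_zero fun i _ => ?_
  simp only [map_smul, smul_eq_mul]
  simp only [hamiltonianField, Sum.elim_inl, Sum.elim_inr]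
  simp only [partialDeriv]
  ring

/-- Conservation of energy. -/
theorem IsHamiltonianSolutionOn.energy_eq {n : ℕ} {H : Phase n → ℝ} {γ : ℝ → Phase n} {b : ℝ}
    (h : IsHamiltonianSolutionOn H γ (Ico 0 b)) (hH : ∀ t ∈ Ico 0 b, DifferentiableAt ℝ H (γ t))
    {t : ℝ} (ht : t ∈ Ico 0 b) : H (γ t) = H (γ 0) := by
  have hd : ∀ s ∈ Ico 0 b, HasDerivWithinAt (H ∘ γ) 0 (Ico 0 b) s := fun s hs => by
    have := (hH s hs).hasFDerivAt.comp_hasDerivWithinAt s (h s hs)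
    rwa [fderiv_hamiltonianField] at this
  have hsub : Icc 0 t ⊆ Ico 0 b := fun r hr => ⟨hr.1, hr.2.trans_lt ht.2⟩
  exact constant_of_has_deriv_right_zero (fun s hs => ((hd s (hsub hs)).mono hsub).continuousWithinAt)
    (fun s hs => hasDerivWithinAt_Ici_of_Ico (hd s (hsub ⟨hs.1, hs.2.le⟩)) (hsub ⟨hs.1, hs.2.le⟩)) t
    ⟨ht.1, le_rfl⟩

/-! ### Explicit equations of motion of the reduced problem -/

namespace Params

variable (p : Params)

/-- The partial derivative of the potential in `R`. -/
noncomputable def potentialR (R z : ℝ) : ℝ :=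
  p.A / R ^ 2 + 3 * p.B / R ^ 4 + 4 * p.A₁ * R / √(R ^ 2 + 4 * z ^ 2) ^ 3
    + 48 * p.B₁ * R / √(R ^ 2 + 4 * z ^ 2) ^ 5

/-- The partial derivative of the potential in `z`. -/
noncomputable def potentialZ (R z : ℝ) : ℝ :=
  16 * p.A₁ * z / √(R ^ 2 + 4 * z ^ 2) ^ 3 + 192 * p.B₁ * z / √(R ^ 2 + 4 * z ^ 2) ^ 5

theorem hasDerivAt_potential {R z : ℝ → ℝ} {R' z' t : ℝ} (hR : HasDerivAt R R' t)
    (hz : HasDerivAt z z' t) (h0 : 0 < R t) :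
    HasDerivAt (fun s => p.potential (R s) (z s))
      (p.potentialR (R t) (z t) * R' + p.potentialZ (R t) (z t) * z') t := by
  have hD : 0 < R t ^ 2 + 4 * z t ^ 2 := by positivity
  have hsq : √(R t ^ 2 + 4 * z t ^ 2) ≠ 0 := (Real.sqrt_pos.2 hD).ne'
  have h1 := (((hR.pow 2).add ((hz.pow 2).const_mul 4)).sqrt hD.ne')
  have h := ((((hasDerivAt_const t (-p.A)).div hR h0.ne').sub
    ((hasDerivAt_const t p.B).div (hR.pow 3) (pow_ne_zero 3 h0.ne'))).sub
    ((hasDerivAt_const t (4 * p.A₁)).div h1 hsq)).sub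
    ((hasDerivAt_const t (16 * p.B₁)).div (h1.pow 3) (pow_ne_zero 3 hsq))
  refine h.congr_deriv ?_
  simp only [potentialR, potentialZ, Pi.add_apply, Pi.pow_apply]
  set D := √(R t ^ 2 + 4 * z t ^ 2)
  have := h0.ne'
  field_simp
  ring

theorem differentiableAt_reducedHamiltonian (C : ℝ) {x : Phase 2} (hx : 0 < x (Sum.inl 0)) :
    DifferentiableAt ℝ (p.reducedHamiltonian C) x := by
  have hD : 0 < x (Sum.inl 0) ^ 2 + 4 * x (Sum.inl 1) ^ 2 := by positivity
  have h1 := hD.ne'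
  have h2 := (Real.sqrt_pos.2 hD).ne'
  have h3 := hx.ne'
  unfold reducedHamiltonian potential
  fun_prop (disch := first | assumption | (apply pow_ne_zero; assumption))

/-- The Hamiltonian vector field of the reduced problem. -/
noncomputable def field (C : ℝ) (x : Phase 2) : Phase 2 :=
  WithLp.toLp 2 (Sum.elim
    ![x (Sum.inr 0) / p.T₁, x (Sum.inr 1) / p.T₂]
    ![2 * C ^ 2 / p.M / x (Sum.inl 0) ^ 3 - p.potentialR (x (Sum.inl 0)) (x (Sum.inl 1)),
      -p.potentialZ (x (Sum.inl 0)) (x (Sum.inl 1))])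

theorem T₁_pos : 0 < p.T₁ := by have := p.M_pos; unfold T₁; positivity

theorem T₂_pos : 0 < p.T₂ := by have := p.M_pos; have := p.m_pos; unfold T₂; positivity

theorem hamiltonianField_eq_field (C : ℝ) {x : Phase 2} (hx : 0 < x (Sum.inl 0)) :
    hamiltonianField (p.reducedHamiltonian C) x = p.field C x := by
  have hM := p.M_pos.ne'
  have hm := p.m_pos.ne'
  have h0 := hx.ne'
  have h2 : 2 * p.M + p.m ≠ 0 := by have := p.M_pos; have := p.m_pos; positivity
  -- The derivative of the Hamiltonian in a general direction (a, b, c, d) is computed once and then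
  -- specialised to the four unit vectors.
  have key : ∀ (j : Fin 2 ⊕ Fin 2) (a b c d e : ℝ), EuclideanSpace.single j (1 : ℝ) =
      (WithLp.toLp 2 (Sum.elim ![a, b] ![c, d]) : Phase 2) →
      1 / p.M * (2 * x (Sum.inr 0) * c - 2 * C ^ 2 / x (Sum.inl 0) ^ 3 * a)
      + (2 * p.M + p.m) / (4 * p.M * p.m) * (2 * x (Sum.inr 1) * d)
      + (p.potentialR (x (Sum.inl 0)) (x (Sum.inl 1)) * a
        + p.potentialZ (x (Sum.inl 0)) (x (Sum.inl 1)) * b) = e →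
      partialDeriv (p.reducedHamiltonian C) j x = e := by
    intro j a b c d e hj he
    refine partialDeriv_eq_of_hasDerivAt (p.differentiableAt_reducedHamiltonian C hx) ?_
    have hl : ∀ i (v : ℝ), HasDerivAt (fun s : ℝ => x i + s * v) v 0 := fun i v => by
      simpa using ((hasDerivAt_id (0 : ℝ)).mul_const v).const_add (x i)
    have hR := hl (Sum.inl 0) a
    have hz := hl (Sum.inl 1) b
    have hP := hl (Sum.inr 0) c
    have hQ := hl (Sum.inr 1) d
    have hp := p.hasDerivAt_potential hR hz (by simpa using hx)
    have := ((((hP.pow 2).add ((hasDerivAt_const (0:ℝ) (C ^ 2)).div (hR.pow 2)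
      (by simpa using h0))).const_mul (1 / p.M)).add
      ((hQ.pow 2).const_mul ((2 * p.M + p.m) / (4 * p.M * p.m)))).add hp
    rw [hj]
    refine (this.congr_deriv ?_).congr_of_eventuallyEq (Eventually.of_forall fun s => ?_)
    · rw [← he]
      simp only [Pi.pow_apply, zero_mul, add_zero, Nat.cast_ofNat]
      field_simp
      ring
    · simp [reducedHamiltonian]
  have e1 := key (Sum.inl 0) 1 0 0 0 _ (by ext i; rcases i with i | i <;> fin_cases i <;> simp) rfl
  have e2 := key (Sum.inl 1) 0 1 0 0 _ (by ext i; rcases i with i | i <;> fin_cases i <;> simp) rfl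
  have e3 := key (Sum.inr 0) 0 0 1 0 _ (by ext i; rcases i with i | i <;> fin_cases i <;> simp) rfl
  have e4 := key (Sum.inr 1) 0 0 0 1 _ (by ext i; rcases i with i | i <;> fin_cases i <;> simp) rfl
  ext i
  rcases i with i | i <;> fin_cases i <;>
    simp only [hamiltonianField, field, Sum.elim_inl, Sum.elim_inr, Fin.zero_eta, Fin.mk_one, e1, e2,
      e3, e4, Matrix.cons_val_zero, Matrix.cons_val_one, T₁, T₂]
  · field_simp; ring
  · field_simp; ring
  · field_simp; ring
  · simp

theorem contDiffOn_field (C : ℝ) : ContDiffOn ℝ 1 (p.field C) {x | 0 < x (Sum.inl 0)} := by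
  intro x hx
  have hx : 0 < x (Sum.inl 0) := hx
  have hD : 0 < x (Sum.inl 0) ^ 2 + 4 * x (Sum.inl 1) ^ 2 := by positivity
  have h1 := hD.ne'
  have h2 := (Real.sqrt_pos.2 hD).ne'
  have h3 := hx.ne'
  refine ContDiffAt.contDiffWithinAt (contDiffAt_euclidean.2 fun i => ?_)
  rcases i with i | i <;> fin_cases i <;>
    simp only [field, potentialR, potentialZ, Sum.elim_inl, Sum.elim_inr, Fin.zero_eta, Fin.mk_one,
      Matrix.cons_val_zero, Matrix.cons_val_one] <;>
    fun_prop (disch := first | assumption | (apply pow_ne_zero; assumption) | skip)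

theorem isOpen_R_pos : IsOpen {x : Phase 2 | 0 < x (Sum.inl 0)} :=
  isOpen_lt continuous_const (by fun_prop)

theorem isMotion_iff {C : ℝ} {γ : ℝ → Phase 2} {b : ℝ} : p.IsMotion C γ b ↔
    IsIntegralCurveOn γ (fun _ => p.field C) (Ico 0 b) ∧
      MapsTo γ (Ico 0 b) {x | 0 < x (Sum.inl 0)} := by
  refine and_congr_left fun hm => forall₂_congr fun t ht => ?_
  simp only [p.hamiltonianField_eq_field C (hm t ht)]

section Motion

variable {p} {C : ℝ} {γ : ℝ → Phase 2} {b t : ℝ}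

theorem IsMotion.hasDerivWithinAt (h : p.IsMotion C γ b) (ht : t ∈ Ico 0 b) (i : Fin 2 ⊕ Fin 2) :
    HasDerivWithinAt (fun s => γ s i) (p.field C (γ t) i) (Ico 0 b) t := by
  exact (EuclideanSpace.proj (𝕜 := ℝ) i).hasFDerivAt.comp_hasDerivWithinAt t
    ((p.isMotion_iff.1 h).1 t ht)

theorem IsMotion.hasDerivWithinAt_R (h : p.IsMotion C γ b) (ht : t ∈ Ico 0 b) :
    HasDerivWithinAt (fun s => γ s (Sum.inl 0)) (γ t (Sum.inr 0) / p.T₁) (Ico 0 b) t :=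
  h.hasDerivWithinAt ht (Sum.inl 0)

theorem IsMotion.hasDerivWithinAt_z (h : p.IsMotion C γ b) (ht : t ∈ Ico 0 b) :
    HasDerivWithinAt (fun s => γ s (Sum.inl 1)) (γ t (Sum.inr 1) / p.T₂) (Ico 0 b) t :=
  h.hasDerivWithinAt ht (Sum.inl 1)

theorem IsMotion.hasDerivWithinAt_P (h : p.IsMotion C γ b) (ht : t ∈ Ico 0 b) :
    HasDerivWithinAt (fun s => γ s (Sum.inr 0)) (2 * C ^ 2 / p.M / γ t (Sum.inl 0) ^ 3
      - p.potentialR (γ t (Sum.inl 0)) (γ t (Sum.inl 1))) (Ico 0 b) t :=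
  h.hasDerivWithinAt ht (Sum.inr 0)

theorem IsMotion.hasDerivWithinAt_Q (h : p.IsMotion C γ b) (ht : t ∈ Ico 0 b) :
    HasDerivWithinAt (fun s => γ s (Sum.inr 1))
      (-p.potentialZ (γ t (Sum.inl 0)) (γ t (Sum.inl 1))) (Ico 0 b) t :=
  h.hasDerivWithinAt ht (Sum.inr 1)

theorem IsMotion.energy_eq (h : p.IsMotion C γ b) (ht : t ∈ Ico 0 b) :
    p.reducedHamiltonian C (γ t) = p.reducedHamiltonian C (γ 0) :=
  IsHamiltonianSolutionOn.energy_eq h.1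
    (fun s hs => p.differentiableAt_reducedHamiltonian C (h.2 s hs)) ht

theorem IsMotion.mem_energyLevel {E : ℝ} (h : p.IsMotion C γ b) (h0 : γ 0 ∈ p.energyLevel C E)
    (ht : t ∈ Ico 0 b) : γ t ∈ p.energyLevel C E :=
  ⟨h.2 t ht, (h.energy_eq ht).trans h0.2⟩

end Motion

end Params

theorem hasDerivAt_phase {n : ℕ} {γ : ℝ → Phase n} {v : Phase n} {t : ℝ}
    (h : ∀ i, HasDerivAt (fun s => γ s i) (v i) t) : HasDerivAt γ v t := by
  rw [← hasDerivWithinAt_univ, hasDerivWithinAt_iff_hasFDerivWithinAt]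
  exact hasFDerivWithinAt_euclidean.2 fun i =>
    (h i).hasFDerivAt.hasFDerivWithinAt.congr_fderiv (by ext; simp)

namespace Params

variable (p : Params)

/-! ### Homographic solutions -/

theorem differentiableAt_hamiltonian {x : Phase 3}
    (hx : 0 < x (Sum.inl 0) ^ 2 + x (Sum.inl 1) ^ 2) : DifferentiableAt ℝ p.hamiltonian x := by
  have h0 := hx.ne'
  have hR := (Real.sqrt_pos.2 hx).ne'
  have hD : √(x (Sum.inl 0) ^ 2 + x (Sum.inl 1) ^ 2) ^ 2 + 4 * x (Sum.inl 2) ^ 2 ≠ 0 := by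
    rw [Real.sq_sqrt hx.le]; positivity
  have h2 : √(√(x (Sum.inl 0) ^ 2 + x (Sum.inl 1) ^ 2) ^ 2 + 4 * x (Sum.inl 2) ^ 2) ≠ 0 := by
    rw [Real.sqrt_ne_zero']
    exact lt_of_le_of_ne (by positivity) hD.symm
  unfold hamiltonian potential
  fun_prop (disch := first | assumption | (apply pow_ne_zero; assumption))

/-- The distance of the equal masses in the unreduced problem. -/
noncomputable def dist₁ (x : Phase 3) : ℝ := √(x (Sum.inl 0) ^ 2 + x (Sum.inl 1) ^ 2)

/-- The Hamiltonian vector field of the unreduced problem. -/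
noncomputable def jacobiField (x : Phase 3) : Phase 3 :=
  WithLp.toLp 2 (Sum.elim
    ![x (Sum.inr 0) / p.T₁, x (Sum.inr 1) / p.T₁, x (Sum.inr 2) / p.T₂]
    ![-(p.potentialR (dist₁ x) (x (Sum.inl 2)) * (x (Sum.inl 0) / dist₁ x)),
      -(p.potentialR (dist₁ x) (x (Sum.inl 2)) * (x (Sum.inl 1) / dist₁ x)),
      -p.potentialZ (dist₁ x) (x (Sum.inl 2))])

theorem hamiltonianField_eq_jacobiField {x : Phase 3}
    (hx : 0 < x (Sum.inl 0) ^ 2 + x (Sum.inl 1) ^ 2) :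
    hamiltonianField p.hamiltonian x = p.jacobiField x := by
  have hM := p.M_pos.ne'
  have hm := p.m_pos.ne'
  have hR0 : 0 < dist₁ x := Real.sqrt_pos.2 hx
  have h2 : 2 * p.M + p.m ≠ 0 := by have := p.M_pos; have := p.m_pos; positivity
  have key : ∀ (j : Fin 3 ⊕ Fin 3) (a b c d e f v : ℝ), EuclideanSpace.single j (1 : ℝ) =
      (WithLp.toLp 2 (Sum.elim ![a, b, c] ![d, e, f]) : Phase 3) →
      1 / p.M * (2 * x (Sum.inr 0) * d + 2 * x (Sum.inr 1) * e)
      + (2 * p.M + p.m) / (4 * p.M * p.m) * (2 * x (Sum.inr 2) * f)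
      + (p.potentialR (dist₁ x) (x (Sum.inl 2)) *
          ((x (Sum.inl 0) * a + x (Sum.inl 1) * b) / dist₁ x)
        + p.potentialZ (dist₁ x) (x (Sum.inl 2)) * c) = v →
      partialDeriv p.hamiltonian j x = v := by
    intro j a b c d e f v hj hv
    refine partialDeriv_eq_of_hasDerivAt (p.differentiableAt_hamiltonian hx) ?_
    have hl : ∀ i (v : ℝ), HasDerivAt (fun s : ℝ => x i + s * v) v 0 := fun i v => by
      simpa using ((hasDerivAt_id (0 : ℝ)).mul_const v).const_add (x i)
    have hR := (((hl (Sum.inl 0) a).pow 2).add ((hl (Sum.inl 1) b).pow 2)).sqrt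
      (by simpa using hx.ne')
    have hp := p.hasDerivAt_potential hR (hl (Sum.inl 2) c) (by simpa using hx)
    have := (((((hl (Sum.inr 0) d).pow 2).add ((hl (Sum.inr 1) e).pow 2)).const_mul (1 / p.M)).add
      (((hl (Sum.inr 2) f).pow 2).const_mul ((2 * p.M + p.m) / (4 * p.M * p.m)))).add hp
    rw [hj]
    refine (this.congr_deriv ?_).congr_of_eventuallyEq (Eventually.of_forall fun s => ?_)
    · rw [← hv]
      simp only [Pi.pow_apply, Pi.add_apply, zero_mul, add_zero, Nat.cast_ofNat]
      simp only [dist₁] at hR0 ⊢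
      field_simp
      ring
    · simp [hamiltonian]
  have ex : ∀ i : Fin 3 ⊕ Fin 3, EuclideanSpace.single i (1 : ℝ) = (WithLp.toLp 2 (Sum.elim
      ![if i = .inl 0 then 1 else 0, if i = .inl 1 then 1 else 0, if i = .inl 2 then 1 else 0]
      ![if i = .inr 0 then 1 else 0, if i = .inr 1 then 1 else 0, if i = .inr 2 then 1 else 0])
      : Phase 3) := by
    intro i
    ext j
    rcases i with i | i <;> rcases j with j | j <;> fin_cases i <;> fin_cases j <;> simp
  ext i
  rcases i with i | i <;> fin_cases i <;>
    simp only [hamiltonianField, jacobiField, Sum.elim_inl, Sum.elim_inr, Fin.zero_eta, Fin.mk_one,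
      Fin.reduceFinMk, key _ _ _ _ _ _ _ _ (ex _) rfl, Matrix.cons_val, T₁, T₂] <;> simp <;>
    (try (field_simp <;> ring))

section Homographic

variable {p} {γ : ℝ → Phase 3} {a b : ℝ}

theorem IsHomographicOn.hasDerivAt (h : p.IsHomographicOn γ (Ioo a b)) {t : ℝ} (ht : t ∈ Ioo a b)
    (i : Fin 3 ⊕ Fin 3) : HasDerivAt (fun s => γ s i) (p.jacobiField (γ t) i) t := by
  have h0 : 0 < γ t (Sum.inl 0) ^ 2 + γ t (Sum.inl 1) ^ 2 :=
    lt_of_le_of_ne (by positivity) (h.2.1 t ht).symm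
  have h1 := (h.1 t ht).hasDerivAt (Ioo_mem_nhds ht.1 ht.2)
  simp only [p.hamiltonianField_eq_jacobiField h0] at h1
  exact (EuclideanSpace.proj (𝕜 := ℝ) i).hasFDerivAt.comp_hasDerivAt t h1

end Homographic

/-- The shape of the planar configurations. -/
noncomputable def planarShape : ℝ × ℝ := (1 / √p.T₁, 0)

theorem shape_zero {R : ℝ} (hR : 0 < R) : p.shape R 0 = p.planarShape := by
  have h := Real.sqrt_pos.2 p.T₁_pos
  simp only [shape, planarShape, size, Prod.mk.injEq, zero_div, and_true]
  rw [show p.T₁ * R ^ 2 + p.T₂ * 0 ^ 2 = p.T₁ * R ^ 2 by ring, Real.sqrt_mul p.T₁_pos.le,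
    Real.sqrt_sq hR.le]
  field_simp

theorem potentialR_pos {R : ℝ} (hR : 0 < R) (z : ℝ) : 0 < p.potentialR R z := by
  have := p.A_pos; have := p.B_pos; have := p.A₁_pos; have := p.B₁_pos
  have : 0 < √(R ^ 2 + 4 * z ^ 2) := Real.sqrt_pos.2 (by positivity)
  unfold potentialR
  positivity

/-- The equal masses circle at distance 1 with the third mass at rest in the middle. The angular
speed is chosen so that T₁ ω² balances the attraction. -/
theorem isHomographicShape_planarShape : p.IsHomographicShape p.planarShape := by
  set ω := √(p.potentialR 1 0 / p.T₁) with hω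
  have hω2 : ω ^ 2 = p.potentialR 1 0 / p.T₁ :=
    Real.sq_sqrt (div_nonneg (p.potentialR_pos one_pos 0).le p.T₁_pos.le)
  have hT := p.T₁_pos.ne'
  refine ⟨fun t => WithLp.toLp 2 (Sum.elim ![Real.cos (ω * t), Real.sin (ω * t), 0]
    ![-(p.T₁ * ω * Real.sin (ω * t)), p.T₁ * ω * Real.cos (ω * t), 0]), -1, 1,
    ⟨?_, fun t _ => by simp, fun _ => 1, fun t => ω * t, 1, 0, 0, by simp,
      fun t _ => by simp⟩, 0, by norm_num, ?_⟩
  · intro t _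
    refine HasDerivAt.hasDerivWithinAt ?_
    have hl : HasDerivAt (fun s : ℝ => ω * s) ω t := by
      simpa using (hasDerivAt_id t).const_mul ω
    have hc := hl.cos
    have hs := hl.sin
    simp only
    rw [p.hamiltonianField_eq_jacobiField (by simp)]
    refine hasDerivAt_phase fun i => ?_
    have hpot : p.potentialR 1 0 = p.T₁ * ω ^ 2 := by rw [hω2]; field_simp
    rcases i with i | i <;> fin_cases i <;> simp [jacobiField, dist₁, hpot, potentialZ]
    · refine hc.congr_deriv ?_; field_simp
    · refine hs.congr_deriv ?_; field_simp
    · exact hasDerivAt_const _ _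
    · refine (hs.const_mul (p.T₁ * ω)).neg.congr_deriv ?_; ring
    · refine (hc.const_mul (p.T₁ * ω)).congr_deriv ?_; ring
    · exact hasDerivAt_const _ _
  · simpa using p.shape_zero one_pos

theorem four_mul_T₁ : 4 * p.T₁ = p.μ * p.T₂ := by
  have := p.M_pos; have := p.m_pos
  unfold T₁ T₂ μ
  field_simp
  norm_num


/-- A continuous non-constant image of a connected set cannot lie in the finite root set of a
nonzero polynomial. -/
theorem eq_zero_of_quadratic {f : ℝ → ℝ} {J : Set ℝ} (hJ : IsPreconnected J)
    (hf : ContinuousOn f J) {c₀ c₁ c₂ : ℝ} (h : ∀ t ∈ J, c₂ * f t ^ 2 + c₁ * f t + c₀ = 0)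
    (hne : ∃ s ∈ J, ∃ t ∈ J, f s ≠ f t) : c₂ = 0 ∧ c₁ = 0 ∧ c₀ = 0 := by
  open Polynomial in
  set q : ℝ[X] := C c₂ * X ^ 2 + C c₁ * X + C c₀ with hq
  have h0 : q = 0 := by
    by_contra hq0
    obtain ⟨s, hs, t, ht, hst⟩ := hne
    have hfin : (q.rootSet ℝ).Countable := (q.rootSet_finite ℝ).countable
    refine hst (hfin.isTotallyDisconnected (f '' J) (image_subset_iff.2 fun r hr => ?_)
      (hJ.image f hf) (mem_image_of_mem f hs) (mem_image_of_mem f ht))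
    rw [mem_preimage, Polynomial.mem_rootSet]
    exact ⟨hq0, by simpa [hq] using h r hr⟩
  refine ⟨?_, ?_, ?_⟩
  · simpa [hq] using congrArg (fun r => Polynomial.coeff r 2) h0
  · simpa [hq] using congrArg (fun r => Polynomial.coeff r 1) h0
  · simpa [hq] using congrArg (fun r => Polynomial.coeff r 0) h0

/-- Eliminating X through X² = (Mα)^{2/3} = (Mβ)^{2/5} gives equality in `hgen`, since 4/15 = 2/3 −
2/5. Here X³ and X⁵ encode the critical point equations of the Newtonian and of the inverse-cube
part. -/
theorem false_of_common_critical_point {M α β X : ℝ} (hM : 0 < M) (hX : 0 < X)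
    (h3 : X ^ 3 = M * α) (h5 : X ^ 5 = M * β)
    (hgen : M ^ (4 / 15 : ℝ) * α ^ (2 / 3 : ℝ) ≠ β ^ (2 / 5 : ℝ)) : False := by
  have hα : α = X ^ 3 / M := by rw [h3]; field_simp
  have hβ : β = X ^ 5 / M := by rw [h5]; field_simp
  refine hgen ?_
  rw [hα, hβ, Real.div_rpow (by positivity) hM.le, Real.div_rpow (by positivity) hM.le,
    ← Real.rpow_natCast X 3, ← Real.rpow_natCast X 5, ← Real.rpow_mul hX.le, ← Real.rpow_mul hX.le]
  have e : M ^ (2 / 3 : ℝ) = M ^ (4 / 15 : ℝ) * M ^ (2 / 5 : ℝ) := by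
    rw [← Real.rpow_add hM]; norm_num
  rw [e]
  have h1 : M ^ (4 / 15 : ℝ) ≠ 0 := (Real.rpow_pos_of_pos hM _).ne'
  norm_num
  field_simp

variable {p} in
/-- Along a homographic solution, the third mass stays in the plane of the equal masses. -/
theorem IsHomographicOn.z_eq_zero (hμ : 1 < p.μ)
    (hgen : (p.μ - 1) ^ (4 / 15 : ℝ) * (4 * p.A₁ / p.A) ^ (2 / 3 : ℝ)
      ≠ (16 * p.B₁ / p.B) ^ (2 / 5 : ℝ)) {γ : ℝ → Phase 3} {a b : ℝ}
    (h : p.IsHomographicOn γ (Ioo a b)) {t : ℝ} (ht : t ∈ Ioo a b) : γ t (Sum.inl 2) = 0 := by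
  by_contra hzt
  have hd := fun s hs => h.hasDerivAt (t := s) hs
  obtain ⟨-, hR0, φ, ψ, a₁, a₂, a₃, -, hφ⟩ := h
  have ha₃ : a₃ ≠ 0 := fun h0 => hzt (by rw [(hφ t ht).2.2.2, h0, mul_zero])
  have hz : ∀ s ∈ Ioo a b, γ s (Sum.inl 2) ≠ 0 := fun s hs => by
    rw [(hφ s hs).2.2.2]; exact mul_ne_zero (hφ s hs).1 ha₃
  set k := (a₁ ^ 2 + a₂ ^ 2) / a₃ ^ 2 with hk
  -- Rotation and common scaling keep |𝐫₁|² / z² constant. `r1` and `r2` below are the first and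
  -- second derivatives of this identity along the motion.
  have hrel : ∀ s ∈ Ioo a b, γ s (Sum.inl 0) ^ 2 + γ s (Sum.inl 1) ^ 2 = k * γ s (Sum.inl 2) ^ 2 :=
      fun s hs => by
    obtain ⟨-, e1, e2, e3⟩ := hφ s hs
    rw [e1, e2, e3, hk]
    field_simp
    linear_combination (φ s ^ 2 * (a₁ ^ 2 + a₂ ^ 2)) * Real.sin_sq_add_cos_sq (ψ s)
  have hk0 : 0 < k := by
    refine lt_of_le_of_ne (by positivity) fun h0 => hR0 t ht ?_
    rw [hrel t ht, ← h0, zero_mul]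
  set x := fun s => γ s (Sum.inl 0)
  set y := fun s => γ s (Sum.inl 1)
  set z := fun s => γ s (Sum.inl 2)
  set X := fun s => γ s (Sum.inr 0)
  set Y := fun s => γ s (Sum.inr 1)
  set Z := fun s => γ s (Sum.inr 2)
  set σ := √k with hσ
  set κ := √(k + 4) with hκ
  have hσ0 : 0 < σ := Real.sqrt_pos.2 hk0
  have hκ0 : 0 < κ := Real.sqrt_pos.2 (by linarith)
  have hσ2 : σ ^ 2 = k := Real.sq_sqrt hk0.le
  have hκ2 : κ ^ 2 = k + 4 := Real.sq_sqrt (by linarith)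
  have hR : ∀ s ∈ Ioo a b, dist₁ (γ s) = σ * |z s| := fun s hs => by
    rw [dist₁, hrel s hs, Real.sqrt_mul hk0.le, Real.sqrt_sq_eq_abs]
  have hDD : ∀ s ∈ Ioo a b, √(dist₁ (γ s) ^ 2 + 4 * z s ^ 2) = κ * |z s| := fun s hs => by
    rw [hR s hs, mul_pow, hσ2, sq_abs, ← add_mul, Real.sqrt_mul (by linarith),
      Real.sqrt_sq_eq_abs]
  have hT₁ := p.T₁_pos
  have hT₂ := p.T₂_pos
  have dx : ∀ s ∈ Ioo a b, HasDerivAt x (X s / p.T₁) s := fun s hs => hd s hs (.inl 0)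
  have dy : ∀ s ∈ Ioo a b, HasDerivAt y (Y s / p.T₁) s := fun s hs => hd s hs (.inl 1)
  have dz : ∀ s ∈ Ioo a b, HasDerivAt z (Z s / p.T₂) s := fun s hs => hd s hs (.inl 2)
  set F := fun s => p.potentialR (dist₁ (γ s)) (z s)
  set G := fun s => p.potentialZ (dist₁ (γ s)) (z s)
  have dX : ∀ s ∈ Ioo a b, HasDerivAt X (-(F s * (x s / dist₁ (γ s)))) s :=
    fun s hs => hd s hs (.inr 0)
  have dY : ∀ s ∈ Ioo a b, HasDerivAt Y (-(F s * (y s / dist₁ (γ s)))) s :=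
    fun s hs => hd s hs (.inr 1)
  have dZ : ∀ s ∈ Ioo a b, HasDerivAt Z (-G s) s := fun s hs => hd s hs (.inr 2)
  have hG : ∀ s ∈ Ioo a b, G s ≠ 0 := fun s hs => by
    have h1 : 0 < κ * |z s| := mul_pos hκ0 (abs_pos.2 (hz s hs))
    have e : G s = z s * (16 * p.A₁ / (κ * |z s|) ^ 3 + 192 * p.B₁ / (κ * |z s|) ^ 5) := by
      simp only [G, potentialZ, hDD s hs]; ring
    rw [e]
    have := p.A₁_pos; have := p.B₁_pos
    exact mul_ne_zero (hz s hs) (by positivity)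
  have hopen : ∀ s ∈ Ioo a b, Ioo a b ∈ 𝓝 s := fun s hs => Ioo_mem_nhds hs.1 hs.2
  have uniq : ∀ {f g : ℝ → ℝ} {f' g' s : ℝ}, s ∈ Ioo a b → (∀ r ∈ Ioo a b, f r = g r) →
      HasDerivAt f f' s → HasDerivAt g g' s → f' = g' := fun hs hfg hf hg =>
    hf.unique (hg.congr_of_eventuallyEq (mem_of_superset (hopen _ hs) hfg))
  have r1 : ∀ s ∈ Ioo a b, (x s * X s + y s * Y s) / p.T₁ = k * (z s * Z s) / p.T₂ := fun s hs => by
    have := uniq hs hrel (((dx s hs).pow 2).add ((dy s hs).pow 2)) (((dz s hs).pow 2).const_mul k)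
    simp only [Nat.cast_ofNat] at this
    linear_combination this / 2
  have r2 : ∀ s ∈ Ioo a b, (X s ^ 2 + Y s ^ 2) / p.T₁ ^ 2 - F s * dist₁ (γ s) / p.T₁
      = k * (Z s ^ 2 / p.T₂ - z s * G s) / p.T₂ := fun s hs => by
    have := uniq hs r1 ((((dx s hs).mul (dX s hs)).add ((dy s hs).mul (dY s hs))).div_const p.T₁)
      ((((dz s hs).mul (dZ s hs)).const_mul k).div_const p.T₂)
    have h1 : 0 < dist₁ (γ s) := by rw [hR s hs]; exact mul_pos hσ0 (abs_pos.2 (hz s hs))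
    have h2 : x s ^ 2 + y s ^ 2 = dist₁ (γ s) ^ 2 := by
      rw [dist₁, Real.sq_sqrt (by positivity)]
    field_simp at this ⊢
    refine mul_left_cancel₀ h1.ne' ?_
    linear_combination this + F s * p.T₁ * p.T₂ ^ 2 * h2
  have hang : ∃ c, ∀ s ∈ Ioo a b, x s * Y s - y s * X s = c := by
    refine ⟨x t * Y t - y t * X t, fun s hs => ?_⟩
    have hder : ∀ r ∈ Ioo a b, HasDerivAt (fun s => x s * Y s - y s * X s) 0 r := fun r hr => by
      refine (((dx r hr).mul (dY r hr)).sub ((dy r hr).mul (dX r hr))).congr_deriv ?_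
      ring
    exact (isOpen_Ioo).is_const_of_deriv_eq_zero isPreconnected_Ioo
      (fun r hr => (hder r hr).differentiableAt.differentiableWithinAt)
      (fun r hr => (hder r hr).deriv) hs ht
  obtain ⟨c, hc⟩ := hang
  -- Lagrange's identity |𝐫₁|² |𝐩₁|² = (𝐫₁ · 𝐩₁)² + c², with `r1` and `r2` inserted, eliminates all
  -- velocities. After multiplication by |z|, the Newtonian terms form the coefficient of |z|² and
  -- the inverse-cube terms the constant coefficient.
  have hquad : ∀ s ∈ Ioo a b,
      (k * p.T₁ * ((p.A / σ + 4 * p.A₁ * k / κ ^ 3) - p.μ * 4 * p.A₁ * k / κ ^ 3)) * |z s| ^ 2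
      + (-c ^ 2) * |z s|
      + k * p.T₁ * ((3 * p.B / σ ^ 3 + 48 * p.B₁ * k / κ ^ 5) - p.μ * 48 * p.B₁ * k / κ ^ 5) = 0 :=
      fun s hs => by
    have hw : 0 < |z s| := abs_pos.2 (hz s hs)
    have hw2 : z s ^ 2 = |z s| ^ 2 := (sq_abs _).symm
    have e1 : z s * G s = 16 * p.A₁ / (κ ^ 3 * |z s|) + 192 * p.B₁ / (κ ^ 5 * |z s| ^ 3) := by
      simp only [G, potentialZ, hDD s hs]
      field_simp
      rw [hw2]
    have e2 : F s * dist₁ (γ s) = p.A / (σ * |z s|) + 3 * p.B / (σ ^ 3 * |z s| ^ 3)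
        + 4 * p.A₁ * k / (κ ^ 3 * |z s|) + 48 * p.B₁ * k / (κ ^ 5 * |z s| ^ 3) := by
      simp only [F, potentialR, hDD s hs]
      rw [hR s hs, ← hσ2]
      field_simp
    have id1 : (x s ^ 2 + y s ^ 2) * (X s ^ 2 + Y s ^ 2) = (x s * X s + y s * Y s) ^ 2 + c ^ 2 := by
      rw [← hc s hs]; ring
    have e3 : x s * X s + y s * Y s = p.T₁ * (k * (z s * Z s) / p.T₂) := by
      rw [← r1 s hs]; field_simp
    have e4 : X s ^ 2 + Y s ^ 2 = p.T₁ ^ 2 * (k * (Z s ^ 2 / p.T₂ - z s * G s) / p.T₂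
        + F s * dist₁ (γ s) / p.T₁) := by
      rw [← r2 s hs]; field_simp; ring
    have e5 : x s ^ 2 + y s ^ 2 = k * z s ^ 2 := hrel s hs
    have e6 : k * z s ^ 2 * (p.T₁ ^ 2 * (- k * (z s * G s) / p.T₂ + F s * dist₁ (γ s) / p.T₁))
        = c ^ 2 := by
      rw [e5, e4, e3] at id1
      linear_combination id1
    have e7 : p.T₁ ^ 2 * (- k * (z s * G s) / p.T₂ + F s * dist₁ (γ s) / p.T₁)
        = p.T₁ * (F s * dist₁ (γ s) - k * p.μ / 4 * (z s * G s)) := by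
      have := p.four_mul_T₁
      field_simp
      linear_combination (-(k * z s * G s)) * this
    rw [e7, e1, e2, hw2] at e6
    rw [← e6]
    field_simp
    ring
  have hzc : ContinuousOn (fun s => |z s|) (Ioo a b) := fun s hs =>
    (dz s hs).continuousAt.abs.continuousWithinAt
  -- If |z| were constant, the vertical momentum and with it the vertical force would vanish, but
  -- the force on the third mass is nonzero off the plane.
  have hne : ∃ s ∈ Ioo a b, ∃ r ∈ Ioo a b, |z s| ≠ |z r| := by
    by_contra! hcon
    have hZ : ∀ s ∈ Ioo a b, Z s = 0 := fun s hs => by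
      have := uniq hs (f := fun r => z r ^ 2) (g := fun _ => |z t| ^ 2)
        (fun r hr => by rw [← sq_abs, hcon r hr t ht]) ((dz s hs).pow 2) (hasDerivAt_const s _)
      have h := hz s hs
      simp only [Nat.cast_ofNat, Nat.add_one_sub_one, pow_one, mul_eq_zero, OfNat.ofNat_ne_zero,
        false_or, div_eq_zero_iff, hT₂.ne', or_false] at this
      exact this.resolve_left h
    have := uniq ht hZ (dZ t ht) (hasDerivAt_const t _)
    exact hG t ht (by simpa using this)
  obtain ⟨h2, -, h0⟩ := eq_zero_of_quadratic isPreconnected_Ioo hzc hquad hne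
  have hkT : k * p.T₁ ≠ 0 := (mul_pos hk0 hT₁).ne'
  have h2 := (mul_eq_zero.1 h2).resolve_left hkT
  have h0 := (mul_eq_zero.1 h0).resolve_left hkT
  rw [← hσ2] at h2 h0
  have hA := p.A_pos
  have hB := p.B_pos
  refine false_of_common_critical_point (X := κ / σ) (sub_pos.2 hμ) (by positivity) ?_ ?_ hgen
  · field_simp at h2 ⊢
    linear_combination h2
  · field_simp at h0 ⊢
    linear_combination h0 / 3

theorem isHomographicShape_iff (hμ : 1 < p.μ)
    (hgen : (p.μ - 1) ^ (4 / 15 : ℝ) * (4 * p.A₁ / p.A) ^ (2 / 3 : ℝ)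
      ≠ (16 * p.B₁ / p.B) ^ (2 / 5 : ℝ)) {s : ℝ × ℝ} :
    p.IsHomographicShape s ↔ s = p.planarShape := by
  refine ⟨?_, fun h => h ▸ p.isHomographicShape_planarShape⟩
  rintro ⟨γ, a, b, hγ, t, ht, rfl⟩
  rw [hγ.z_eq_zero hμ hgen ht]
  exact p.shape_zero (Real.sqrt_pos.2 (lt_of_le_of_ne (by positivity) (hγ.2.1 t ht).symm))

end Params

/-! ### A Barbalat-type lemma -/

/-- In the time dτ = dt / ρ, q' = η and η' is bounded. If η reached ε, it would stay above ε/2 for a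
fixed scaled time, in which q would move by more than its smallness near b allows. -/
theorem eventually_lt_of_slow_variation {q η ρ g ρ' : ℝ → ℝ} {a b K ε : ℝ} (hab : a < b)
    (hε : 0 < ε) (hK : 0 < K)
    (hρ : ∀ t ∈ Ioo a b, 0 < ρ t)
    (dq : ∀ t ∈ Ioo a b, HasDerivAt q (η t / ρ t) t)
    (dη : ∀ t ∈ Ioo a b, HasDerivAt η (g t / ρ t) t)
    (dρ : ∀ t ∈ Ioo a b, HasDerivAt ρ (ρ' t) t)
    (hg : ∀ t ∈ Ioo a b, |g t| ≤ K) (hρ' : ∀ t ∈ Ioo a b, |ρ' t| ≤ K)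
    (hρ0 : Tendsto ρ (𝓝[<] b) (𝓝 0)) (hq0 : Tendsto q (𝓝[<] b) (𝓝 0)) :
    ∀ᶠ t in 𝓝[<] b, η t < ε := by
  -- The window is [t₀, t₀ + c ρ(t₀)]. The first bound keeps ρ between half and three halves of
  -- ρ(t₀), the second keeps η above ε/2.
  set c := min (1 / (2 * K)) (ε / (4 * K))
  have hc : 0 < c := by positivity
  have hc1 : K * c ≤ 1 / 2 := by
    calc K * c ≤ K * (1 / (2 * K)) := by gcongr; exact min_le_left _ _
      _ = 1 / 2 := by field_simp
  have hc2 : 2 * K * c ≤ ε / 2 := by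
    calc 2 * K * c ≤ 2 * K * (ε / (4 * K)) := by gcongr; exact min_le_right _ _
      _ = ε / 2 := by field_simp; norm_num
  -- Over the window q grows by at least ε c / 3, so |q| < ε c / 6 at both ends is contradictory.
  have hδ : 0 < ε * c / 6 := by positivity
  have hev : ∀ᶠ t in 𝓝[<] b, |q t| < ε * c / 6 := by
    have := hq0.abs
    rw [abs_zero] at this
    exact this.eventually (gt_mem_nhds hδ)
  obtain ⟨l, hl, hlq⟩ := mem_nhdsLT_iff_exists_Ioo_subset.1
    (inter_mem hev (Ioo_mem_nhdsLT hab))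
  filter_upwards [Ioo_mem_nhdsLT hl] with t₀ ht₀
  by_contra! hη
  have hsub : Ico t₀ b ⊆ Ioo a b := fun s hs => (hlq ⟨ht₀.1.trans_le hs.1, hs.2⟩).2
  have hqs : ∀ s ∈ Ico t₀ b, |q s| < ε * c / 6 := fun s hs =>
    (hlq ⟨ht₀.1.trans_le hs.1, hs.2⟩).1
  have ht₀' : t₀ ∈ Ico t₀ b := ⟨le_rfl, ht₀.2⟩
  have hρt : 0 < ρ t₀ := hρ t₀ (hsub ht₀')
  have lipρ : ∀ s ∈ Ico t₀ b, |ρ s - ρ t₀| ≤ K * (s - t₀) := fun s hs => by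
    have := (convex_Ico t₀ b).norm_image_sub_le_of_norm_hasDerivWithin_le
      (fun r hr => (dρ r (hsub hr)).hasDerivWithinAt) (fun r hr => hρ' r (hsub hr)) ht₀' hs
    rwa [Real.norm_eq_abs, Real.norm_eq_abs, abs_of_nonneg (by linarith [hs.1] : 0 ≤ s - t₀)] at this
  -- Since ρ tends to 0 at b with slope at most K, and K c ≤ 1/2, the window ends before b.
  have hρb : ρ t₀ ≤ K * (b - t₀) := by
    have h1 : Tendsto (fun s => ρ t₀ - ρ s) (𝓝[<] b) (𝓝 (ρ t₀ - 0)) := tendsto_const_nhds.sub hρ0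
    rw [sub_zero] at h1
    refine le_of_tendsto h1 ?_
    filter_upwards [Ioo_mem_nhdsLT ht₀.2] with s hs
    have := (abs_le.1 (lipρ s ⟨hs.1.le, hs.2⟩)).1
    nlinarith [hs.2]
  set t₂ := t₀ + c * ρ t₀ with ht₂
  have ht₂b : t₂ < b := by
    have : c * ρ t₀ ≤ c * (K * (b - t₀)) := by gcongr
    nlinarith [ht₀.2]
  have ht02 : t₀ < t₂ := by have := mul_pos hc hρt; linarith
  have hsub2 : Icc t₀ t₂ ⊆ Ico t₀ b := fun s hs => ⟨hs.1, hs.2.trans_lt ht₂b⟩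
  have hρs : ∀ s ∈ Icc t₀ t₂, ρ t₀ / 2 ≤ ρ s ∧ ρ s ≤ 3 / 2 * ρ t₀ := fun s hs => by
    have h1 := abs_le.1 (lipρ s (hsub2 hs))
    have h2 : K * (s - t₀) ≤ ρ t₀ / 2 := by
      calc K * (s - t₀) ≤ K * (c * ρ t₀) := by gcongr; linarith [hs.2]
        _ = K * c * ρ t₀ := by ring
        _ ≤ 1 / 2 * ρ t₀ := by gcongr
        _ = ρ t₀ / 2 := by ring
    constructor <;> linarith [h1.1, h1.2]
  have hηs : ∀ s ∈ Icc t₀ t₂, ε / 2 ≤ η s := fun s hs => by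
    have := (convex_Icc t₀ t₂).norm_image_sub_le_of_norm_hasDerivWithin_le (C := 2 * K / ρ t₀)
      (fun r hr => (dη r (hsub (hsub2 hr))).hasDerivWithinAt) (fun r hr => by
        rw [Real.norm_eq_abs, abs_div, abs_of_pos (hρ r (hsub (hsub2 hr))),
          div_le_div_iff₀ (hρ r (hsub (hsub2 hr))) hρt]
        have := hg r (hsub (hsub2 hr))
        nlinarith [(hρs r hr).1]) (left_mem_Icc.2 ht02.le) hs
    rw [Real.norm_eq_abs, Real.norm_eq_abs, abs_of_nonneg (by linarith [hs.1] : 0 ≤ s - t₀)] at this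
    have h3 : 2 * K / ρ t₀ * (s - t₀) ≤ ε / 2 := by
      calc 2 * K / ρ t₀ * (s - t₀) ≤ 2 * K / ρ t₀ * (c * ρ t₀) := by gcongr; linarith [hs.2]
        _ = 2 * K * c := by field_simp
        _ ≤ ε / 2 := hc2
    linarith [(abs_le.1 this).1]
  have hmvt := (convex_Icc t₀ t₂).mul_sub_le_image_sub_of_le_deriv (f := q) (C := ε / (3 * ρ t₀))
    (fun r hr => (dq r (hsub (hsub2 hr))).continuousAt.continuousWithinAt)
    (fun r hr => (dq r (hsub (hsub2 (interior_subset hr)))).differentiableAt.differentiableWithinAt)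
    (fun r hr => by
      have hr' := interior_subset hr
      rw [(dq r (hsub (hsub2 hr'))).deriv, div_le_div_iff₀ (by positivity)
        (hρ r (hsub (hsub2 hr')))]
      nlinarith [(hρs r hr').2, hηs r hr']) t₀ (left_mem_Icc.2 ht02.le) t₂
        (right_mem_Icc.2 ht02.le) ht02.le
  have e : ε / (3 * ρ t₀) * (t₂ - t₀) = ε * c / 3 := by rw [ht₂]; field_simp; ring
  have h1 := abs_lt.1 (hqs t₀ ht₀')
  have h2 := abs_lt.1 (hqs t₂ ⟨ht02.le, ht₂b⟩)
  rw [e] at hmvt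
  linarith [h1.1, h2.2]

theorem tendsto_zero_of_slow_variation {q η ρ g ρ' : ℝ → ℝ} {a b K : ℝ} (hab : a < b)
    (hK : 0 < K) (hρ : ∀ t ∈ Ioo a b, 0 < ρ t)
    (dq : ∀ t ∈ Ioo a b, HasDerivAt q (η t / ρ t) t)
    (dη : ∀ t ∈ Ioo a b, HasDerivAt η (g t / ρ t) t)
    (dρ : ∀ t ∈ Ioo a b, HasDerivAt ρ (ρ' t) t)
    (hg : ∀ t ∈ Ioo a b, |g t| ≤ K) (hρ' : ∀ t ∈ Ioo a b, |ρ' t| ≤ K)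
    (hρ0 : Tendsto ρ (𝓝[<] b) (𝓝 0)) (hq0 : Tendsto q (𝓝[<] b) (𝓝 0)) :
    Tendsto η (𝓝[<] b) (𝓝 0) := by
  rw [Metric.tendsto_nhds]
  intro ε hε
  have h1 := eventually_lt_of_slow_variation hab hε hK hρ dq dη dρ hg hρ' hρ0 hq0
  have h2 := eventually_lt_of_slow_variation (q := fun t => -q t) (η := fun t => -η t)
    (g := fun t => -g t) hab hε hK hρ
    (fun t ht => (dq t ht).neg.congr_deriv (by ring))
    (fun t ht => (dη t ht).neg.congr_deriv (by ring)) dρ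
    (fun t ht => by simpa using hg t ht) hρ' hρ0 (by simpa using hq0.neg)
  filter_upwards [h1, h2] with t h1 h2
  rw [Real.dist_eq, sub_zero, abs_lt]
  constructor <;> linarith

namespace Params

variable (p : Params)

/-! ### Scaled variables -/

/-- The slope `z / R`. -/
noncomputable def slope (x : Phase 2) : ℝ := x (Sum.inl 1) / x (Sum.inl 0)

/-- The time scale `R^{5/2}`. -/
noncomputable def timeScale (x : Phase 2) : ℝ := x (Sum.inl 0) ^ 2 * √(x (Sum.inl 0))

/-- The scaled radial velocity `R^{3/2} Ṙ`. -/
noncomputable def radialVel (x : Phase 2) : ℝ :=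
  √(x (Sum.inl 0)) * x (Sum.inl 0) * (x (Sum.inr 0) / p.T₁)

/-- The derivative `R^{1/2} (R ż - z Ṙ)` of the slope in the scaled time. -/
noncomputable def slopeVel (x : Phase 2) : ℝ :=
  √(x (Sum.inl 0)) *
    (x (Sum.inl 0) * (x (Sum.inr 1) / p.T₂) - x (Sum.inl 1) * (x (Sum.inr 0) / p.T₁))

/-- The coefficient of the restoring force in the equation of the slope `q` at distance `R`. -/
noncomputable def stiffness (C q R : ℝ) : ℝ :=
  (16 * p.A₁ * R ^ 2 / √(1 + 4 * q ^ 2) ^ 3 + 192 * p.B₁ / √(1 + 4 * q ^ 2) ^ 5) / p.T₂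
    + (2 * C ^ 2 / p.M * R - p.A * R ^ 2 - 3 * p.B - 4 * p.A₁ * R ^ 2 / √(1 + 4 * q ^ 2) ^ 3
      - 48 * p.B₁ / √(1 + 4 * q ^ 2) ^ 5) / p.T₁

/-- The scaled kinetic energy on the energy level `h`. -/
noncomputable def scaledKinetic (C h q R : ℝ) : ℝ :=
  p.B + 16 * p.B₁ / √(1 + 4 * q ^ 2) ^ 3 + h * R ^ 3
    + (p.A + 4 * p.A₁ / √(1 + 4 * q ^ 2)) * R ^ 2 - C ^ 2 / p.M * R

theorem sqrt_sq_add_eq {R : ℝ} (hR : 0 < R) (z : ℝ) :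
    √(R ^ 2 + 4 * z ^ 2) = R * √(1 + 4 * (z / R) ^ 2) := by
  rw [show R ^ 2 + 4 * z ^ 2 = R ^ 2 * (1 + 4 * (z / R) ^ 2) by field_simp,
    Real.sqrt_mul (by positivity), Real.sqrt_sq hR.le]

/-- This is the energy integral multiplied by R³, with η + qν = R^{3/2} ż. It replaces the energy
level by a relation that extends continuously to R = 0. -/
theorem scaledKinetic_eq {C h : ℝ} {x : Phase 2} (hx : x ∈ p.energyLevel C h) :
    p.T₁ * p.radialVel x ^ 2 / 2 + p.T₂ * (p.slopeVel x + slope x * p.radialVel x) ^ 2 / 2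
      = p.scaledKinetic C h (slope x) (x (Sum.inl 0)) := by
  obtain ⟨hR, hE⟩ := hx
  have hS := Real.sqrt_pos.2 hR
  have hS2 := Real.sq_sqrt hR.le
  have hd : 0 < √(1 + 4 * (slope x) ^ 2) := Real.sqrt_pos.2 (by positivity)
  have h1 := p.T₁_pos.ne'
  have h2 := p.T₂_pos.ne'
  have hM := p.M_pos.ne'
  have hm := p.m_pos.ne'
  have h3 : 2 * p.M + p.m ≠ 0 := by have := p.M_pos; have := p.m_pos; positivity
  have e0 : p.slopeVel x + slope x * p.radialVel x
      = √(x (Sum.inl 0)) * x (Sum.inl 0) * (x (Sum.inr 1) / p.T₂) := by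
    simp only [slopeVel, slope, radialVel]
    field_simp
    ring
  rw [e0, ← hE]
  simp only [reducedHamiltonian, potential, scaledKinetic, sqrt_sq_add_eq hR, radialVel]
  simp only [slope] at hd ⊢
  set D := √(1 + 4 * (x (Sum.inl 1) / x (Sum.inl 0)) ^ 2)
  set S := √(x (Sum.inl 0))
  simp only [mul_pow, hS2]
  simp only [T₁, T₂]
  field_simp
  ring

section Motion

variable {p} {C : ℝ} {γ : ℝ → Phase 2} {b t : ℝ}

theorem timeScale_pos {x : Phase 2} (hx : 0 < x (Sum.inl 0)) : 0 < timeScale x := by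
  have := Real.sqrt_pos.2 hx
  unfold timeScale
  positivity

theorem IsMotion.hasDerivWithinAt_R' (h : p.IsMotion C γ b) (ht : t ∈ Ico 0 b) :
    HasDerivWithinAt (fun s => γ s (Sum.inl 0))
      (p.radialVel (γ t) * γ t (Sum.inl 0) / timeScale (γ t)) (Ico 0 b) t := by
  refine (h.hasDerivWithinAt_R ht).congr_deriv ?_
  have hR := h.2 t ht
  have hS := Real.sqrt_pos.2 hR
  have := p.T₁_pos
  simp only [radialVel, timeScale]
  field_simp

theorem IsMotion.hasDerivWithinAt_slope (h : p.IsMotion C γ b) (ht : t ∈ Ico 0 b) :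
    HasDerivWithinAt (fun s => slope (γ s)) (p.slopeVel (γ t) / timeScale (γ t)) (Ico 0 b) t := by
  have hR := h.2 t ht
  have hS := Real.sqrt_pos.2 hR
  have := p.T₁_pos; have := p.T₂_pos
  refine ((h.hasDerivWithinAt_z ht).div (h.hasDerivWithinAt_R ht) hR.ne').congr_deriv ?_
  simp only [slopeVel, timeScale]
  field_simp

theorem IsMotion.hasDerivWithinAt_timeScale (h : p.IsMotion C γ b) (ht : t ∈ Ico 0 b) :
    HasDerivWithinAt (fun s => timeScale (γ s)) (5 / 2 * p.radialVel (γ t)) (Ico 0 b) t := by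
  have hR := h.2 t ht
  have hS := Real.sqrt_pos.2 hR
  have hS2 := Real.sq_sqrt hR.le
  have := p.T₁_pos
  have hd := h.hasDerivWithinAt_R ht
  refine ((hd.pow 2).mul (hd.sqrt hR.ne')).congr_deriv ?_
  simp only [radialVel, Pi.pow_apply]
  field_simp
  rw [hS2]
  ring

/-- The factor √R contributes νη/2, which is friction during collapse. The bracket has derivative R
z̈ − z R̈, which is divisible by z and gives the restoring force. -/
theorem IsMotion.hasDerivWithinAt_slopeVel (h : p.IsMotion C γ b) (ht : t ∈ Ico 0 b) :
    HasDerivWithinAt (fun s => p.slopeVel (γ s))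
      ((p.radialVel (γ t) * p.slopeVel (γ t) / 2
        - slope (γ t) * p.stiffness C (slope (γ t)) (γ t (Sum.inl 0))) / timeScale (γ t))
      (Ico 0 b) t := by
  have hR := h.2 t ht
  have hS := Real.sqrt_pos.2 hR
  have hS2 := Real.sq_sqrt hR.le
  have hd : 0 < √(1 + 4 * (slope (γ t)) ^ 2) := Real.sqrt_pos.2 (by positivity)
  have := p.T₁_pos; have := p.T₂_pos; have := p.M_pos
  have dR := h.hasDerivWithinAt_R ht
  refine ((dR.sqrt hR.ne').mul ((dR.mul ((h.hasDerivWithinAt_Q ht).div_const p.T₂)).sub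
    ((h.hasDerivWithinAt_z ht).mul ((h.hasDerivWithinAt_P ht).div_const p.T₁)))).congr_deriv ?_
  simp only [radialVel, slopeVel, timeScale, stiffness, potentialR, potentialZ, sqrt_sq_add_eq hR]
  simp only [slope] at hd ⊢
  set D := √(1 + 4 * (γ t (Sum.inl 1) / γ t (Sum.inl 0)) ^ 2)
  simp only [Pi.sub_apply, Pi.mul_apply]
  generalize √(γ t (Sum.inl 0)) = S at *
  generalize γ t (Sum.inl 0) = R at *
  subst hS2
  field_simp
  ring

end Motion

end Params

theorem tendsto_of_continuous_uncurry {α : Type*} {l : Filter α} {f : ℝ → ℝ → ℝ}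
    (hf : Continuous fun y : ℝ × ℝ => f y.1 y.2) {u v : α → ℝ} {a b : ℝ} (hu : Tendsto u l (𝓝 a))
    (hv : Tendsto v l (𝓝 b)) : Tendsto (fun t => f (u t) (v t)) l (𝓝 (f a b)) :=
  (hf.tendsto (a, b)).comp (hu.prodMk_nhds hv)

namespace Params

variable (p : Params)

/-! ### Limits at planar triple collisions -/

theorem sqrt_slope_pos (q : ℝ) : 0 < √(1 + 4 * q ^ 2) := Real.sqrt_pos.2 (by positivity)

theorem continuous_stiffness (C : ℝ) : Continuous fun y : ℝ × ℝ => p.stiffness C y.1 y.2 := by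
  have h : ∀ (n : ℕ) (y : ℝ × ℝ), √(1 + 4 * y.1 ^ 2) ^ n ≠ 0 :=
    fun n y => pow_ne_zero n (sqrt_slope_pos y.1).ne'
  have h1 := p.T₁_pos.ne'
  have h2 := p.T₂_pos.ne'
  unfold stiffness
  fun_prop (disch := first | assumption | (intro y; apply h))

theorem continuous_scaledKinetic (C E : ℝ) :
    Continuous fun y : ℝ × ℝ => p.scaledKinetic C E y.1 y.2 := by
  have h : ∀ (n : ℕ) (y : ℝ × ℝ), √(1 + 4 * y.1 ^ 2) ^ n ≠ 0 :=
    fun n y => pow_ne_zero n (sqrt_slope_pos y.1).ne'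
  have h' : ∀ (y : ℝ × ℝ), √(1 + 4 * y.1 ^ 2) ≠ 0 := fun y => (sqrt_slope_pos y.1).ne'
  unfold scaledKinetic
  fun_prop (disch := first | assumption | (intro y; apply h))

/-- The scaled speed `√(2 (B + 16 B₁) / T₁)` of the planar collapse. -/
noncomputable def collapseSpeed : ℝ := √(2 * (p.B + 16 * p.B₁) / p.T₁)

theorem collapseSpeed_pos : 0 < p.collapseSpeed := by
  have := p.B_pos; have := p.B₁_pos; have := p.T₁_pos
  exact Real.sqrt_pos.2 (by positivity)

theorem scaledKinetic_zero (C E : ℝ) :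
    p.scaledKinetic C E 0 0 = p.T₁ * p.collapseSpeed ^ 2 / 2 := by
  have := p.B_pos; have := p.B₁_pos; have := p.T₁_pos
  rw [collapseSpeed, Real.sq_sqrt (by positivity)]
  simp [scaledKinetic]
  field_simp

/-- The motion `γ` ends, at the time `t₁`, in a triple collision with planar limiting shape. -/
def IsPlanarCollision (γ : ℝ → Phase 2) (t₁ : ℝ) : Prop :=
  Tendsto (fun t => γ t (Sum.inl 0)) (𝓝[<] t₁) (𝓝 0) ∧
    Tendsto (fun t => slope (γ t)) (𝓝[<] t₁) (𝓝 0)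

section

variable {p} {C E : ℝ} {γ : ℝ → Phase 2} {t₁ : ℝ}

theorem hasDerivAt_of_Ico {f : ℝ → ℝ} {f' b t : ℝ}
    (h : HasDerivWithinAt f f' (Ico 0 b) t) (ht : t ∈ Ioo 0 b) : HasDerivAt f f' t :=
  h.hasDerivAt (Ico_mem_nhds ht.1 ht.2)

theorem IsPlanarCollision.tendsto_scaledKinetic (C E : ℝ) (h : IsPlanarCollision γ t₁) :
    Tendsto (fun t => p.scaledKinetic C E (slope (γ t)) (γ t (Sum.inl 0))) (𝓝[<] t₁)
      (𝓝 (p.T₁ * p.collapseSpeed ^ 2 / 2)) := by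
  rw [← p.scaledKinetic_zero C E]
  exact tendsto_of_continuous_uncurry (p.continuous_scaledKinetic C E) h.2 h.1

/-- Both kinetic terms are nonnegative and their sum has a finite limit. This bounds ν and η + qν,
hence also η once |q| < 1. -/
theorem IsMotion.eventually_bounded (hm : p.IsMotion C γ t₁) (ht₁ : 0 < t₁)
    (h0 : γ 0 ∈ p.energyLevel C E) (h : IsPlanarCollision γ t₁) :
    ∃ K > 0, ∀ᶠ t in 𝓝[<] t₁, |p.radialVel (γ t)| ≤ K ∧ |p.slopeVel (γ t)| ≤ K := by
  have hT₁ := p.T₁_pos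
  have hT₂ := p.T₂_pos
  obtain ⟨e, he'⟩ : ∃ e, p.T₁ * p.collapseSpeed ^ 2 / 2 < e := exists_gt _
  have he : 0 < e := lt_of_le_of_lt (by positivity) he'
  have hlt := (h.tendsto_scaledKinetic (p := p) C E).eventually
    (gt_mem_nhds he')
  have hq : ∀ᶠ t in 𝓝[<] t₁, |slope (γ t)| < 1 := by
    have := h.2.abs
    rw [abs_zero] at this
    exact this.eventually (gt_mem_nhds one_pos)
  set K₁ := √(2 * e / p.T₁)
  set K₂ := √(2 * e / p.T₂)
  have hK₁ : 0 < K₁ := Real.sqrt_pos.2 (by positivity)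
  have hK₂ : 0 < K₂ := Real.sqrt_pos.2 (by positivity)
  refine ⟨K₁ + K₂, by positivity, ?_⟩
  filter_upwards [hlt, hq, Ioo_mem_nhdsLT ht₁] with t hlt hq ht
  have hk := p.scaledKinetic_eq (hm.mem_energyLevel h0 ⟨ht.1.le, ht.2⟩)
  rw [← hk] at hlt
  have a1 : 0 ≤ p.T₁ * p.radialVel (γ t) ^ 2 / 2 := by positivity
  have a2 : 0 ≤ p.T₂ * (p.slopeVel (γ t) + slope (γ t) * p.radialVel (γ t)) ^ 2 / 2 := by positivity
  have b1 : |p.radialVel (γ t)| ≤ K₁ := Real.abs_le_sqrt (by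
    rw [le_div_iff₀ hT₁]; linarith)
  have b2 : |p.slopeVel (γ t) + slope (γ t) * p.radialVel (γ t)| ≤ K₂ := Real.abs_le_sqrt (by
    rw [le_div_iff₀ hT₂]; linarith)
  refine ⟨by linarith, ?_⟩
  have b3 : |slope (γ t) * p.radialVel (γ t)| ≤ K₁ := by
    rw [abs_mul]
    nlinarith [abs_nonneg (slope (γ t)), abs_nonneg (p.radialVel (γ t))]
  rw [abs_le] at *
  constructor <;> linarith [b2.1, b2.2, b3.1, b3.2]

theorem IsPlanarCollision.tendsto_timeScale (h : IsPlanarCollision γ t₁) :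
    Tendsto (fun t => timeScale (γ t)) (𝓝[<] t₁) (𝓝 0) := by
  have : Tendsto (fun R : ℝ => R ^ 2 * √R) (𝓝 0) (𝓝 0) := by
    have hc : Continuous fun R : ℝ => R ^ 2 * √R := by fun_prop
    simpa using hc.tendsto 0
  exact this.comp h.1

theorem IsMotion.tendsto_slopeVel (hm : p.IsMotion C γ t₁) (ht₁ : 0 < t₁)
    (h0 : γ 0 ∈ p.energyLevel C E) (h : IsPlanarCollision γ t₁) :
    Tendsto (fun t => p.slopeVel (γ t)) (𝓝[<] t₁) (𝓝 0) := by
  obtain ⟨K, hK, hbd⟩ := hm.eventually_bounded ht₁ h0 h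
  have hstiff : ∀ᶠ t in 𝓝[<] t₁,
      |slope (γ t) * p.stiffness C (slope (γ t)) (γ t (Sum.inl 0))| < 1 := by
    have h1 : Tendsto (fun t => p.stiffness C (slope (γ t)) (γ t (Sum.inl 0))) (𝓝[<] t₁)
        (𝓝 (p.stiffness C 0 0)) :=
      tendsto_of_continuous_uncurry (p.continuous_stiffness C) h.2 h.1
    have := (h.2.mul h1).abs
    rw [zero_mul, abs_zero] at this
    exact this.eventually (gt_mem_nhds one_pos)
  obtain ⟨a, ha, hsub⟩ := mem_nhdsLT_iff_exists_Ioo_subset.1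
    (inter_mem (inter_mem hbd hstiff) (Ioo_mem_nhdsLT ht₁))
  -- K² + 1 bounds the scaled acceleration of the slope, and 3K bounds the derivative 5ν/2 of the
  -- time scale.
  refine tendsto_zero_of_slow_variation (a := a) (K := K ^ 2 + 3 * K + 1) ha (by positivity)
    (fun t ht => timeScale_pos (hm.2 t ⟨(hsub ht).2.1.le, ht.2⟩))
    (fun t ht => hasDerivAt_of_Ico (hm.hasDerivWithinAt_slope ⟨(hsub ht).2.1.le, ht.2⟩)
      (hsub ht).2)
    (fun t ht => hasDerivAt_of_Ico (hm.hasDerivWithinAt_slopeVel ⟨(hsub ht).2.1.le, ht.2⟩)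
      (hsub ht).2)
    (fun t ht => hasDerivAt_of_Ico (hm.hasDerivWithinAt_timeScale ⟨(hsub ht).2.1.le, ht.2⟩)
      (hsub ht).2) (fun t ht => ?_) (fun t ht => ?_) h.tendsto_timeScale h.2
  · obtain ⟨⟨⟨h1, h2⟩, h3⟩, -⟩ := hsub ht
    have h4 : |p.radialVel (γ t) * p.slopeVel (γ t) / 2| ≤ K ^ 2 := by
      rw [abs_div, abs_mul, abs_two]
      have := mul_le_mul h1 h2 (abs_nonneg _) hK.le
      nlinarith
    have h5 := abs_sub (p.radialVel (γ t) * p.slopeVel (γ t) / 2)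
      (slope (γ t) * p.stiffness C (slope (γ t)) (γ t (Sum.inl 0)))
    have h3' : |slope (γ t) * p.stiffness C (slope (γ t)) (γ t (Sum.inl 0))| < 1 := h3
    linarith
  · obtain ⟨⟨⟨h1, h2⟩, h3⟩, -⟩ := hsub ht
    rw [abs_mul, abs_of_pos (by norm_num : (0 : ℝ) < 5 / 2)]
    nlinarith

/-- With η → 0 the energy relation gives ν² → c². Near t₁ the continuous function ν then has no
zero; a positive sign would make R increase, contradicting R → 0. -/
theorem IsMotion.tendsto_radialVel (hm : p.IsMotion C γ t₁) (ht₁ : 0 < t₁)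
    (h0 : γ 0 ∈ p.energyLevel C E) (h : IsPlanarCollision γ t₁) :
    Tendsto (fun t => p.radialVel (γ t)) (𝓝[<] t₁) (𝓝 (-p.collapseSpeed)) := by
  have hT₁ := p.T₁_pos
  have hc := p.collapseSpeed_pos
  obtain ⟨K, hK, hbd⟩ := hm.eventually_bounded ht₁ h0 h
  have hη := hm.tendsto_slopeVel ht₁ h0 h
  have hqν : Tendsto (fun t => slope (γ t) * p.radialVel (γ t)) (𝓝[<] t₁) (𝓝 0) := by
    refine bdd_le_mul_tendsto_zero' (f := fun t => p.radialVel (γ t)) K (hbd.mono fun t ht => ht.1)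
      h.2 |>.congr fun t => mul_comm _ _
  have hsq : Tendsto (fun t => p.radialVel (γ t) ^ 2) (𝓝[<] t₁) (𝓝 (p.collapseSpeed ^ 2)) := by
    have h1 := ((h.tendsto_scaledKinetic (p := p) C E).sub
      ((((hη.add hqν).pow 2).const_mul p.T₂).div_const 2)).const_mul (2 / p.T₁)
    have e1 : 2 / p.T₁ * (p.T₁ * p.collapseSpeed ^ 2 / 2 - p.T₂ * (0 + 0) ^ 2 / 2)
        = p.collapseSpeed ^ 2 := by field_simp; ring
    rw [e1] at h1
    refine h1.congr' ?_
    filter_upwards [Ioo_mem_nhdsLT ht₁] with t ht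
    rw [← p.scaledKinetic_eq (hm.mem_energyLevel h0 ⟨ht.1.le, ht.2⟩)]
    field_simp
    ring
  have hpos := hsq.eventually (lt_mem_nhds (show 0 < p.collapseSpeed ^ 2 by positivity))
  obtain ⟨a, ha, hsub⟩ := mem_nhdsLT_iff_exists_Ioo_subset.1
    (inter_mem hpos (Ioo_mem_nhdsLT ht₁))
  have hneg : ∀ t ∈ Ioo a t₁, p.radialVel (γ t) < 0 := by
    intro t ht
    by_contra! hge
    have hne : ∀ s ∈ Ioo a t₁, p.radialVel (γ s) ≠ 0 := fun s hs h' => by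
      have : 0 < p.radialVel (γ s) ^ 2 := (hsub hs).1
      simp [h'] at this
    have hcont : ContinuousOn (fun s => p.radialVel (γ s)) (Ioo a t₁) := fun s hs => by
      have hd := hm.hasDerivWithinAt_timeScale ⟨(hsub hs).2.1.le, (hsub hs).2.2⟩
      have hR := hasDerivAt_of_Ico (hm.hasDerivWithinAt_R ⟨(hsub hs).2.1.le, (hsub hs).2.2⟩)
        (hsub hs).2
      have hP := hasDerivAt_of_Ico (hm.hasDerivWithinAt_P ⟨(hsub hs).2.1.le, (hsub hs).2.2⟩)
        (hsub hs).2
      exact ((hR.continuousAt.sqrt.mul hR.continuousAt).mul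
        (hP.continuousAt.div_const _)).continuousWithinAt
    have hall : ∀ s ∈ Ioo a t₁, 0 < p.radialVel (γ s) := fun s hs => by
      by_contra! hs'
      obtain ⟨r, hr, hr0⟩ := isPreconnected_Ioo.intermediate_value hs ht hcont ⟨hs', hge⟩
      exact hne r hr hr0
    have hmono : MonotoneOn (fun s => γ s (Sum.inl 0)) (Ioo a t₁) := by
      refine monotoneOn_of_deriv_nonneg (convex_Ioo _ _) (fun s hs => ?_) (fun s hs => ?_)
        fun s hs => ?_
      · exact (hasDerivAt_of_Ico (hm.hasDerivWithinAt_R ⟨(hsub hs).2.1.le, (hsub hs).2.2⟩)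
          (hsub hs).2).continuousAt.continuousWithinAt
      · rw [interior_Ioo] at hs
        exact (hasDerivAt_of_Ico (hm.hasDerivWithinAt_R ⟨(hsub hs).2.1.le, (hsub hs).2.2⟩)
          (hsub hs).2).differentiableAt.differentiableWithinAt
      · rw [interior_Ioo] at hs
        have hs' : s ∈ Ico 0 t₁ := ⟨(hsub hs).2.1.le, (hsub hs).2.2⟩
        rw [(hasDerivAt_of_Ico (hm.hasDerivWithinAt_R' hs') (hsub hs).2).deriv]
        have := hall s hs; have := hm.2 s hs'; have := timeScale_pos (hm.2 s hs')
        positivity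
    have hRt : 0 < γ t (Sum.inl 0) := hm.2 t ⟨(hsub ht).2.1.le, ht.2⟩
    refine absurd (ge_of_tendsto h.1 (b := γ t (Sum.inl 0)) ?_) (not_le.2 hRt)
    filter_upwards [Ioo_mem_nhdsLT ht.2] with s hs
    exact hmono ht ⟨ht.1.trans hs.1, hs.2⟩ hs.1.le
  have := (hsq.sqrt).neg
  rw [Real.sqrt_sq hc.le] at this
  refine this.congr' ?_
  filter_upwards [Ioo_mem_nhdsLT ha] with t ht
  rw [Real.sqrt_sq_eq_abs, abs_of_neg (hneg t ht), neg_neg]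

end

/-! ### McGehee coordinates in terms of the scaled variables -/

/-- The ratio `r / R` at slope `q`. -/
noncomputable def sizeRatio (q : ℝ) : ℝ := √(p.T₁ + p.T₂ * q ^ 2)

theorem sizeRatio_pos (q : ℝ) : 0 < p.sizeRatio q := by
  have := p.T₁_pos; have := p.T₂_pos
  exact Real.sqrt_pos.2 (by positivity)

theorem size_eq {R : ℝ} (hR : 0 < R) (z : ℝ) : p.size R z = R * p.sizeRatio (z / R) := by
  have := p.T₁_pos; have := p.T₂_pos
  rw [size, sizeRatio, show p.T₁ * R ^ 2 + p.T₂ * z ^ 2 = R ^ 2 * (p.T₁ + p.T₂ * (z / R) ^ 2) by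
    field_simp, Real.sqrt_mul (by positivity), Real.sqrt_sq hR.le]

theorem shape_eq {R : ℝ} (hR : 0 < R) (z : ℝ) :
    p.shape R z = (1 / p.sizeRatio (z / R), (z / R) / p.sizeRatio (z / R)) := by
  have := p.sizeRatio_pos (z / R)
  rw [shape, p.size_eq hR]
  congr 1 <;> field_simp

/-- The quantity `R^{3/2} r (𝐬 · 𝐩) / R` in the scaled variables. -/
noncomputable def scaledDot (q ν η : ℝ) : ℝ := p.T₁ * ν + p.T₂ * q * (η + q * ν)

/-- The McGehee coordinates as functions of the scaled variables. -/
noncomputable def mcGeheeOfScaled (R q ν η : ℝ) : ℝ × ℝ × ℝ × ℝ :=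
  let m := p.sizeRatio q
  let th := Real.arctan (√p.T₂ * q / √p.T₁)
  (R * m, m ^ (3 / 2 : ℝ) * (p.scaledDot q ν η / m), th,
    Real.cos th ^ 3 / √(p.W th * Real.cos th ^ 3) *
      (Real.cos th * (√p.T₂ * (m ^ (3 / 2 : ℝ) *
          (η + q * ν - p.scaledDot q ν η / m * (q / m))))
        - Real.sin th * (√p.T₁ * (m ^ (3 / 2 : ℝ) *
          (ν - p.scaledDot q ν η / m * (1 / m))))))

/-- The weight r^{3/2} absorbs the singular powers of R in the momenta, so R survives only in r
itself. The right-hand side therefore makes sense at R = 0. -/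
theorem mcGehee_eq {x : Phase 2} (hx : 0 < x (Sum.inl 0)) :
    p.mcGehee x = p.mcGeheeOfScaled (x (Sum.inl 0)) (slope x) (p.radialVel x) (p.slopeVel x) := by
  have hS := Real.sqrt_pos.2 hx
  have hS2 := Real.sq_sqrt hx.le
  have hT₁ := p.T₁_pos; have hT₂ := p.T₂_pos
  have hm := p.sizeRatio_pos (slope x)
  have hr : p.r x = x (Sum.inl 0) * p.sizeRatio (slope x) := p.size_eq hx _
  have hsh : p.shape (x (Sum.inl 0)) (x (Sum.inl 1)) =
      (1 / p.sizeRatio (slope x), slope x / p.sizeRatio (slope x)) := p.shape_eq hx _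
  have hR32 : x (Sum.inl 0) ^ (3 / 2 : ℝ) = x (Sum.inl 0) * √(x (Sum.inl 0)) := by
    rw [Real.sqrt_eq_rpow, ← Real.rpow_one_add' hx.le (by norm_num)]
    norm_num
  have hr32 : p.r x ^ (3 / 2 : ℝ) =
      x (Sum.inl 0) * √(x (Sum.inl 0)) * p.sizeRatio (slope x) ^ (3 / 2 : ℝ) := by
    rw [hr, Real.mul_rpow hx.le hm.le, hR32]
  have hP : x (Sum.inl 0) * √(x (Sum.inl 0)) * x (Sum.inr 0) = p.T₁ * p.radialVel x := by
    rw [radialVel]; field_simp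
  have hQ : x (Sum.inl 0) * √(x (Sum.inl 0)) * x (Sum.inr 1)
      = p.T₂ * (p.slopeVel x + slope x * p.radialVel x) := by
    simp only [slopeVel, slope, radialVel]; field_simp; ring
  have hdot : x (Sum.inl 0) * √(x (Sum.inl 0)) * p.sDotP x =
      p.scaledDot (slope x) (p.radialVel x) (p.slopeVel x) / p.sizeRatio (slope x) := by
    rw [sDotP, hsh, scaledDot]
    simp only
    rw [eq_div_iff hm.ne']
    field_simp
    linear_combination hP + slope x * hQ
  have hθ : p.θ x = Real.arctan (√p.T₂ * slope x / √p.T₁) := by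
    have := Real.sqrt_pos.2 hT₁
    rw [θ, slope]
    congr 1
    field_simp
  have hv : p.v x = p.sizeRatio (slope x) ^ (3 / 2 : ℝ) *
      (p.scaledDot (slope x) (p.radialVel x) (p.slopeVel x) / p.sizeRatio (slope x)) := by
    rw [v, hr32, ← hdot]; ring
  have hu₁ : p.r x ^ (3 / 2 : ℝ) * (x (Sum.inr 0) / p.T₁ - p.sDotP x * (1 / p.sizeRatio (slope x)))
      = p.sizeRatio (slope x) ^ (3 / 2 : ℝ) * (p.radialVel x
        - p.scaledDot (slope x) (p.radialVel x) (p.slopeVel x) / p.sizeRatio (slope x)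
          * (1 / p.sizeRatio (slope x))) := by
    have e : p.radialVel x = x (Sum.inl 0) * √(x (Sum.inl 0)) * x (Sum.inr 0) / p.T₁ := by
      rw [hP]; field_simp
    rw [hr32, ← hdot, e]
    ring
  have hu₂ : p.r x ^ (3 / 2 : ℝ) *
        (x (Sum.inr 1) / p.T₂ - p.sDotP x * (slope x / p.sizeRatio (slope x)))
      = p.sizeRatio (slope x) ^ (3 / 2 : ℝ) * (p.slopeVel x + slope x * p.radialVel x
        - p.scaledDot (slope x) (p.radialVel x) (p.slopeVel x) / p.sizeRatio (slope x)
          * (slope x / p.sizeRatio (slope x))) := by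
    have e : p.slopeVel x + slope x * p.radialVel x
        = x (Sum.inl 0) * √(x (Sum.inl 0)) * x (Sum.inr 1) / p.T₂ := by
      rw [hQ]; field_simp
    rw [hr32, ← hdot, e]
    ring
  rw [mcGehee, w, u]
  simp only [hsh, hu₁, hu₂, hv, hθ]
  rw [hr]
  rfl

theorem continuousAt_W : ContinuousAt p.W 0 := by
  unfold W
  refine continuousAt_const.mul (ContinuousAt.add ?_ ?_)
  · exact continuousAt_const.div (by fun_prop) (by simp)
  · refine continuousAt_const.div (ContinuousAt.rpow_const (by fun_prop) (Or.inl (by simp)))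
      (by simp)

theorem W_zero : p.W 0 = p.T₁ ^ (3 / 2 : ℝ) * (p.B + 16 * p.B₁) := by
  simp [W, T₁]

theorem mcGeheeOfScaled_collapse :
    p.mcGeheeOfScaled 0 0 (-p.collapseSpeed) 0 = p.QStar := by
  have hT := p.T₁_pos
  have hm : p.sizeRatio 0 = √p.T₁ := by simp [sizeRatio]
  have hs := Real.sqrt_pos.2 hT
  have h1 : √p.T₁ ^ (3 / 2 : ℝ) / √p.T₁ * p.T₁ * p.collapseSpeed = √(2 * p.W 0) := by
    have hB := p.B_pos; have hB₁ := p.B₁_pos; have hc := p.collapseSpeed_pos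
    symm
    rw [Real.sqrt_eq_iff_mul_self_eq_of_pos (by positivity), W_zero]
    have e1 : √p.T₁ ^ (3 / 2 : ℝ) * √p.T₁ ^ (3 / 2 : ℝ) = p.T₁ ^ (3 / 2 : ℝ) := by
      rw [← Real.mul_rpow hs.le hs.le, Real.mul_self_sqrt hT.le]
    have e2 : p.collapseSpeed * p.collapseSpeed = 2 * (p.B + 16 * p.B₁) / p.T₁ :=
      Real.mul_self_sqrt (by positivity)
    have e3 : √p.T₁ ^ 2 = p.T₁ := Real.sq_sqrt hT.le
    calc _ = √p.T₁ ^ (3 / 2 : ℝ) * √p.T₁ ^ (3 / 2 : ℝ) / √p.T₁ ^ 2 * p.T₁ ^ 2 *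
          (p.collapseSpeed * p.collapseSpeed) := by field_simp
      _ = _ := by rw [e1, e2, e3]; field_simp
  simp only [mcGeheeOfScaled, QStar, hm, scaledDot, ← h1]
  simp
  ring

theorem continuousAt_mcGeheeOfScaled (ν : ℝ) : ContinuousAt
    (fun y : ℝ × ℝ × ℝ × ℝ => p.mcGeheeOfScaled y.1 y.2.1 y.2.2.1 y.2.2.2) (0, 0, ν, 0) := by
  have hm : ContinuousAt (fun y : ℝ × ℝ × ℝ × ℝ => p.sizeRatio y.2.1) (0, 0, ν, 0) := by
    unfold sizeRatio
    fun_prop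
  have hm0 := (p.sizeRatio_pos 0).ne'
  have hm32 : ContinuousAt (fun y : ℝ × ℝ × ℝ × ℝ => p.sizeRatio y.2.1 ^ (3 / 2 : ℝ))
    (0, 0, ν, 0) := hm.rpow_const (Or.inl hm0)
  have hsd : ContinuousAt (fun y : ℝ × ℝ × ℝ × ℝ => p.scaledDot y.2.1 y.2.2.1 y.2.2.2)
      (0, 0, ν, 0) := by
    unfold scaledDot
    fun_prop
  have hdm := hsd.div hm hm0
  have hth : ContinuousAt (fun y : ℝ × ℝ × ℝ × ℝ => Real.arctan (√p.T₂ * y.2.1 / √p.T₁))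
      (0, 0, ν, 0) := by fun_prop
  have hW : ContinuousAt
      (fun y : ℝ × ℝ × ℝ × ℝ => p.W (Real.arctan (√p.T₂ * y.2.1 / √p.T₁))) (0, 0, ν, 0) :=
    ContinuousAt.comp (g := p.W) (by simpa using p.continuousAt_W) hth
  have hW0 : 0 < p.W 0 := by
    have := p.B_pos; have := p.B₁_pos; have := p.T₁_pos
    rw [W_zero]; positivity
  have hcos : ContinuousAt (fun y : ℝ × ℝ × ℝ × ℝ => Real.cos (Real.arctan (√p.T₂ * y.2.1 / √p.T₁)))
      (0, 0, ν, 0) := by fun_prop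
  have hsin : ContinuousAt (fun y : ℝ × ℝ × ℝ × ℝ => Real.sin (Real.arctan (√p.T₂ * y.2.1 / √p.T₁)))
      (0, 0, ν, 0) := by fun_prop
  have hq : ContinuousAt (fun y : ℝ × ℝ × ℝ × ℝ => y.2.1) (0, 0, ν, 0) := by fun_prop
  have hν : ContinuousAt (fun y : ℝ × ℝ × ℝ × ℝ => y.2.2.1) (0, 0, ν, 0) := by fun_prop
  have hη : ContinuousAt (fun y : ℝ × ℝ × ℝ × ℝ => y.2.2.2) (0, 0, ν, 0) := by fun_prop
  unfold mcGeheeOfScaled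
  refine ContinuousAt.prodMk (continuousAt_fst.mul hm) (ContinuousAt.prodMk (hm32.mul hdm)
    (ContinuousAt.prodMk hth (ContinuousAt.mul ?_ ?_)))
  · exact (hcos.pow 3).div (hW.mul (hcos.pow 3)).sqrt (by simpa using (Real.sqrt_pos.2 hW0).ne')
  · exact (hcos.mul (continuousAt_const.mul (hm32.mul ((hη.add (hq.mul hν)).sub
      (hdm.mul (hq.div hm hm0)))))).sub (hsin.mul (continuousAt_const.mul (hm32.mul
      (hν.sub (hdm.mul (continuousAt_const.div hm hm0))))))

section

variable {p} {C E : ℝ} {γ : ℝ → Phase 2} {t₁ : ℝ}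

/-- Towards planar collision only r and θ matter: r ≥ √T₁ R, and q is a multiple of tan θ. The
converse combines the limits of ν and η with continuity of the coordinates at the collapse. -/
theorem IsMotion.tendsto_QStar_iff (hm : p.IsMotion C γ t₁) (ht₁ : 0 < t₁)
    (h0 : γ 0 ∈ p.energyLevel C E) :
    Tendsto (fun t => p.mcGehee (γ t)) (𝓝[<] t₁) (𝓝 p.QStar) ↔ IsPlanarCollision γ t₁ := by
  have hpos : ∀ᶠ t in 𝓝[<] t₁, 0 < γ t (Sum.inl 0) := by
    filter_upwards [Ioo_mem_nhdsLT ht₁] with t ht using hm.2 t ⟨ht.1.le, ht.2⟩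
  have hT₁ := Real.sqrt_pos.2 p.T₁_pos
  have hT₂ := Real.sqrt_pos.2 p.T₂_pos
  constructor
  · intro h
    have hr : Tendsto (fun t => p.r (γ t)) (𝓝[<] t₁) (𝓝 0) :=
      (continuous_fst.tendsto p.QStar).comp h
    have hθ : Tendsto (fun t => p.θ (γ t)) (𝓝[<] t₁) (𝓝 0) :=
      ((continuous_fst.comp (continuous_snd.comp continuous_snd)).tendsto p.QStar).comp h
    constructor
    · have h1 := hr.div_const √p.T₁
      rw [zero_div] at h1
      refine squeeze_zero' (hpos.mono fun t ht => ht.le) (hpos.mono fun t ht => ?_) h1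
      rw [le_div_iff₀ hT₁, r, size_eq p ht]
      refine mul_le_mul_of_nonneg_left (Real.sqrt_le_sqrt ?_) ht.le
      have := p.T₂_pos
      nlinarith [mul_nonneg this.le (sq_nonneg (γ t (Sum.inl 1) / γ t (Sum.inl 0)))]
    · have h1 := ((Real.continuousAt_tan.2 (by simp : Real.cos 0 ≠ 0)).tendsto.comp hθ).const_mul
        (√p.T₁ / √p.T₂)
      rw [Real.tan_zero, mul_zero] at h1
      refine h1.congr' (hpos.mono fun t ht => ?_)
      simp only [Function.comp, θ, Real.tan_arctan, slope]
      field_simp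
  · intro h
    have h1 := hm.tendsto_radialVel ht₁ h0 h
    have h2 := hm.tendsto_slopeVel ht₁ h0 h
    rw [← p.mcGeheeOfScaled_collapse]
    refine (((p.continuousAt_mcGeheeOfScaled (-p.collapseSpeed)).tendsto).comp
      (h.1.prodMk_nhds (h.2.prodMk_nhds (h1.prodMk_nhds h2)))).congr' ?_
    exact hpos.mono fun t ht => (p.mcGehee_eq ht).symm

theorem IsMotion.planarCollision_iff (hm : p.IsMotion C γ t₁) (ht₁ : 0 < t₁) :
    EndsInTripleCollision γ t₁ ∧ p.HasLimitingShape γ t₁ p.planarShape ↔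
      IsPlanarCollision γ t₁ := by
  have hpos : ∀ᶠ t in 𝓝[<] t₁, 0 < γ t (Sum.inl 0) := by
    filter_upwards [Ioo_mem_nhdsLT ht₁] with t ht using hm.2 t ⟨ht.1.le, ht.2⟩
  have hT₁ := Real.sqrt_pos.2 p.T₁_pos
  constructor
  · rintro ⟨h1, h2⟩
    refine ⟨(continuous_fst.tendsto ((0, 0) : ℝ × ℝ)).comp h1, ?_⟩
    have h3 := ((continuous_snd.tendsto p.planarShape).comp h2).div
      ((continuous_fst.tendsto p.planarShape).comp h2) (by simp [planarShape, hT₁.ne'])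
    rw [show p.planarShape.2 = 0 from rfl, zero_div] at h3
    refine h3.congr' (hpos.mono fun t ht => ?_)
    have := p.sizeRatio_pos (γ t (Sum.inl 1) / γ t (Sum.inl 0))
    simp only [Function.comp, Pi.div_apply, shape_eq p ht, slope]
    field_simp
  · rintro ⟨h1, h2⟩
    constructor
    · refine h1.prodMk_nhds ?_
      have := h2.mul h1
      rw [mul_zero] at this
      refine this.congr' (hpos.mono fun t ht => ?_)
      simp only [slope]
      field_simp
    · have hm : Tendsto (fun t => p.sizeRatio (slope (γ t))) (𝓝[<] t₁) (𝓝 √p.T₁) := by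
        have hc : Continuous p.sizeRatio := by unfold sizeRatio; fun_prop
        have := (hc.tendsto 0).comp h2
        simpa [Function.comp_def, show p.sizeRatio 0 = √p.T₁ by simp [sizeRatio]] using this
      have h3 := (tendsto_const_nhds (x := (1 : ℝ)).div hm hT₁.ne').prodMk_nhds
        (h2.div hm hT₁.ne')
      rw [zero_div] at h3
      exact h3.congr' (hpos.mono fun t ht => (p.shape_eq ht _).symm)

end

/-! ### Both sets of initial conditions are the set of planar collisions -/

/-- The initial conditions in the energy level whose motion ends in a triple collision with planar
limiting shape. -/
def planarCollisionSet (C E : ℝ) : Set (Phase 2) :=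
  {x | x ∈ p.energyLevel C E ∧ ∃ (γ : ℝ → Phase 2) (t₁ : ℝ), 0 < t₁ ∧ γ 0 = x ∧
    p.IsMotion C γ t₁ ∧ IsPlanarCollision γ t₁}

theorem basinQStar_eq (C E : ℝ) : p.basinQStar C E = p.planarCollisionSet C E := by
  ext x
  refine and_congr_right fun hx => exists_congr fun γ => exists_congr fun t₁ =>
    and_congr_right fun ht₁ => and_congr_right fun h0 => and_congr_right fun hm => ?_
  exact hm.tendsto_QStar_iff ht₁ (h0 ▸ hx)

theorem homographicCollisionSet_eq (hμ : 1 < p.μ)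
    (hgen : (p.μ - 1) ^ (4 / 15 : ℝ) * (4 * p.A₁ / p.A) ^ (2 / 3 : ℝ)
      ≠ (16 * p.B₁ / p.B) ^ (2 / 5 : ℝ)) (C E : ℝ) :
    p.homographicCollisionSet C E = p.planarCollisionSet C E := by
  ext x
  refine and_congr_right fun hx => exists_congr fun γ => exists_congr fun t₁ =>
    and_congr_right fun ht₁ => and_congr_right fun h0 => and_congr_right fun hm => ?_
  rw [← hm.planarCollision_iff ht₁]
  simp only [p.isHomographicShape_iff hμ hgen, exists_eq_left]

end Params

/-! ### A trapping region near the planar collapse -/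

/-- The Lyapunov function of the damped oscillator satisfied by the slope. -/
noncomputable def lyapunov (δ k q η : ℝ) : ℝ := η ^ 2 / 2 + δ * q * η + k * q ^ 2 / 2

/-- The bound on δ lets the quadratic terms dominate the cross term, so `lyapunov` is comparable to
η² + k q². -/
theorem abs_mul_le_of_sq_le {δ k : ℝ} (hk : 0 < k) (hδ : δ ^ 2 ≤ k / 4) (q η : ℝ) :
    |δ * q * η| ≤ (η ^ 2 + k * q ^ 2) / 4 := by
  refine abs_le_of_sq_le_sq ?_ (by positivity)
  have h1 : (δ * q * η) ^ 2 ≤ k / 4 * (q ^ 2 * η ^ 2) := by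
    rw [show (δ * q * η) ^ 2 = δ ^ 2 * (q ^ 2 * η ^ 2) by ring]
    gcongr
  nlinarith [sq_nonneg (η ^ 2 - k * q ^ 2)]

theorem le_lyapunov {δ k : ℝ} (hk : 0 < k) (hδ : δ ^ 2 ≤ k / 4) (q η : ℝ) :
    (η ^ 2 + k * q ^ 2) / 4 ≤ lyapunov δ k q η := by
  have := (abs_le.1 (abs_mul_le_of_sq_le hk hδ q η)).1
  unfold lyapunov
  linarith

theorem lyapunov_le {δ k : ℝ} (hk : 0 < k) (hδ : δ ^ 2 ≤ k / 4) (q η : ℝ) :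
    lyapunov δ k q η ≤ η ^ 2 + k * q ^ 2 := by
  have := (abs_le.1 (abs_mul_le_of_sq_le hk hδ q η)).2
  have h : 0 ≤ η ^ 2 + k * q ^ 2 := by positivity
  unfold lyapunov
  linarith

/-- The left side is the derivative of `lyapunov` along q' = η, η' = νη/2 − κq. It equals (ν/2 + δ)
η² − δκ q² + (k − κ + δν/2) q η. Friction makes the first term negative, the cross term supplies the
second, and `hδ2` is the discriminant condition under which half of each absorbs the mixed term. -/
theorem lyapunov_deriv_le {δ k c ν κ : ℝ} (hk : 0 < k) (hc : 0 < c) (hδ0 : 0 < δ)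
    (hδ1 : δ ≤ c / 8) (hδ2 : δ ≤ k / (64 * c)) (hδ3 : δ ^ 2 ≤ k / 4) (hν1 : -(2 * c) ≤ ν)
    (hν2 : ν ≤ -c / 2) (hκ1 : |κ - k| ≤ δ * c) (hκ2 : k / 2 ≤ κ) (q η : ℝ) :
    η * (ν * η / 2 - q * κ) + δ * (η * η + q * (ν * η / 2 - q * κ)) + k * q * η
      ≤ -(min (c / 16) (δ / 4)) * lyapunov δ k q η := by
  have h1 : (ν / 2 + δ) * η ^ 2 ≤ -(c / 8) * η ^ 2 := by
    refine mul_le_mul_of_nonneg_right ?_ (sq_nonneg η); linarith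
  have h2 : δ * (k / 2) * q ^ 2 ≤ δ * κ * q ^ 2 := by gcongr
  have h3 : |q * η * (k - κ + δ * ν / 2)| ≤ 2 * δ * c * |q * η| := by
    rw [abs_mul, mul_comm]
    refine mul_le_mul_of_nonneg_right ?_ (abs_nonneg _)
    rw [abs_le] at hκ1 ⊢
    constructor <;> nlinarith [hκ1.1, hκ1.2]
  have h4 : 2 * δ * c * |q * η| ≤ c / 16 * η ^ 2 + δ * k / 4 * q ^ 2 := by
    refine le_of_sq_le_sq ?_ (by positivity)
    rw [mul_pow, sq_abs]
    have h5 : (2 * δ * c) ^ 2 ≤ 4 * (c / 16) * (δ * k / 4) := by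
      rw [le_div_iff₀ (by positivity)] at hδ2
      nlinarith [mul_le_mul_of_nonneg_left hδ2 (by positivity : 0 ≤ δ * c)]
    have h6 : (2 * δ * c) ^ 2 * (q * η) ^ 2 ≤ 4 * (c / 16) * (δ * k / 4) * (q * η) ^ 2 := by gcongr
    nlinarith [sq_nonneg (c / 16 * η ^ 2 - δ * k / 4 * q ^ 2)]
  have h7 : min (c / 16) (δ / 4) * lyapunov δ k q η ≤ c / 16 * η ^ 2 + δ * k / 4 * q ^ 2 := by
    have hm : 0 < min (c / 16) (δ / 4) := by positivity
    calc min (c / 16) (δ / 4) * lyapunov δ k q η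
        ≤ min (c / 16) (δ / 4) * (η ^ 2 + k * q ^ 2) := by
          gcongr; exact lyapunov_le hk hδ3 q η
      _ = min (c / 16) (δ / 4) * η ^ 2 + min (c / 16) (δ / 4) * (k * q ^ 2) := by ring
      _ ≤ c / 16 * η ^ 2 + δ / 4 * (k * q ^ 2) := by
          gcongr
          · exact min_le_left _ _
          · exact min_le_right _ _
      _ = _ := by ring
  have h8 := (abs_le.1 h3).2
  nlinarith

/-- Forward invariance of a region `R < ε`, `L < ℓ`, `ν < 0` in which `R` and `L` decrease and `ν`
stays away from zero. -/
theorem forall_mem_region {R L ν R' L' : ℝ → ℝ} {b ε ℓ c : ℝ} (hc : 0 < c)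
    (dR : ∀ t ∈ Ico 0 b, HasDerivWithinAt R (R' t) (Ico 0 b) t)
    (dL : ∀ t ∈ Ico 0 b, HasDerivWithinAt L (L' t) (Ico 0 b) t)
    (hν : ContinuousOn ν (Ico 0 b))
    (h : ∀ t ∈ Ico 0 b, R t < ε → L t < ℓ → ν t < 0 → ν t ≤ -c ∧ R' t ≤ 0 ∧ L' t ≤ 0)
    (hR0 : R 0 < ε) (hL0 : L 0 < ℓ) (hν0 : ν 0 < 0) :
    ∀ t ∈ Ico 0 b, R t < ε ∧ L t < ℓ ∧ ν t < 0 := by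
  intro t ht
  have hRc : ContinuousOn R (Ico 0 b) := fun s hs => (dR s hs).continuousWithinAt
  have hLc : ContinuousOn L (Ico 0 b) := fun s hs => (dL s hs).continuousWithinAt
  have hsub : Icc 0 t ⊆ Ico 0 b := fun s hs => ⟨hs.1, hs.2.trans_lt ht.2⟩
  -- Continuous induction runs on closed conditions that imply the open ones with room to spare. The
  -- gap between −c and 0 prevents ν from leaving the region.
  set S : Set ℝ := {s | R s ≤ R 0 ∧ L s ≤ L 0 ∧ ν s ≤ -c}
  have hS : Icc 0 t ⊆ S := by
    refine IsClosed.Icc_subset_of_forall_exists_gt ?_ ?_ ?_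
    · have e : S ∩ Icc 0 t = (Icc 0 t ∩ R ⁻¹' Iic (R 0)) ∩ ((Icc 0 t ∩ L ⁻¹' Iic (L 0)) ∩
          (Icc 0 t ∩ ν ⁻¹' Iic (-c))) := by
        ext s; simp only [S, mem_inter_iff, mem_ofPred_eq, mem_preimage, mem_Iic]; tauto
      rw [e]
      exact ((hRc.mono hsub).preimage_isClosed_of_isClosed isClosed_Icc isClosed_Iic).inter
        (((hLc.mono hsub).preimage_isClosed_of_isClosed isClosed_Icc isClosed_Iic).inter
        ((hν.mono hsub).preimage_isClosed_of_isClosed isClosed_Icc isClosed_Iic))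
    · exact ⟨le_rfl, le_rfl, (h 0 ⟨le_rfl, ht.1.trans_lt ht.2⟩ hR0 hL0 hν0).1⟩
    · rintro s ⟨⟨s1, s2, s3⟩, hs⟩ y hy
      have hsb : s ∈ Ico 0 b := hsub ⟨hs.1, hs.2.le⟩
      have hev : ∀ᶠ r in 𝓝[Ico 0 b] s, R r < ε ∧ L r < ℓ ∧ ν r < 0 :=
        ((hRc s hsb).eventually (gt_mem_nhds (s1.trans_lt hR0))).and
          (((hLc s hsb).eventually (gt_mem_nhds (s2.trans_lt hL0))).and
          ((hν s hsb).eventually (gt_mem_nhds (s3.trans_lt (by linarith)))))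
      obtain ⟨d, hd, hdsub⟩ := Metric.mem_nhdsWithin_iff.1 hev
      obtain ⟨r, hsr, hr⟩ := exists_between
        (lt_min (lt_min hy hsb.2) (show s < s + d by linarith))
      have hrb : r < b := hr.trans_le ((min_le_left _ _).trans (min_le_right _ _))
      have hrd : r < s + d := hr.trans_le (min_le_right _ _)
      have hin : ∀ r' ∈ Icc s r, r' ∈ Ico 0 b ∧ R r' < ε ∧ L r' < ℓ ∧ ν r' < 0 := fun r' hr' => by
        have h1 : r' ∈ Ico 0 b := ⟨hs.1.trans hr'.1, hr'.2.trans_lt hrb⟩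
        refine ⟨h1, hdsub ⟨?_, h1⟩⟩
        rw [Metric.mem_ball, Real.dist_eq, abs_of_nonneg (by linarith [hr'.1])]
        linarith [hr'.2]
      have anti : ∀ {f f' : ℝ → ℝ}, (∀ t ∈ Ico 0 b, HasDerivWithinAt f (f' t) (Ico 0 b) t) →
          (∀ r' ∈ Icc s r, f' r' ≤ 0) → f r ≤ f s := by
        intro f f' df hf
        refine antitoneOn_of_hasDerivWithinAt_nonpos (f' := f') (convex_Icc s r)
          (fun r' hr' => ((df r' (hin r' hr').1).continuousWithinAt).mono
            fun x hx => (hin x hx).1)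
          (fun r' hr' => (df r' (hin r' (interior_subset hr')).1).mono
            fun x hx => (hin x (interior_subset hx)).1)
          (fun r' hr' => hf r' (interior_subset hr')) (left_mem_Icc.2 hsr.le)
          (right_mem_Icc.2 hsr.le) hsr.le
      have key := fun r' hr' => h r' (hin r' hr').1 (hin r' hr').2.1 (hin r' hr').2.2.1
        (hin r' hr').2.2.2
      exact ⟨r, ⟨(anti dR fun r' hr' => (key r' hr').2.1).trans s1,
        (anti dL fun r' hr' => (key r' hr').2.2).trans s2, (key r (right_mem_Icc.2 hsr.le)).1⟩,
        hsr, (hr.trans_le ((min_le_left _ _).trans (min_le_left _ _))).le⟩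
  obtain ⟨h1, h2, h3⟩ := hS (right_mem_Icc.2 ht.1)
  exact ⟨h1.trans_lt hR0, h2.trans_lt hL0, by linarith⟩

namespace Params

variable (p : Params)

/-- The value is 3 (16 B₁ (μ − 1) − B) / T₁, so `hB` is exactly the condition that the force
restores the planar shape. -/
theorem stiffness_zero_pos (hB : 1 + p.B / (16 * p.B₁) < p.μ) (C : ℝ) :
    0 < p.stiffness C 0 0 := by
  have := p.B₁_pos
  have h1 := p.T₁_pos
  have h2 := p.T₂_pos
  have e : p.stiffness C 0 0 = 3 * (16 * p.B₁ * (p.μ - 1) - p.B) / p.T₁ := by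
    have := p.four_mul_T₁
    simp [stiffness]
    field_simp
    linear_combination 48 * p.B₁ * this
  rw [e]
  have h3 : p.B / (16 * p.B₁) < p.μ - 1 := by linarith
  rw [div_lt_iff₀ (by positivity)] at h3
  exact div_pos (by linarith) h1

/-- Near q = R = 0 the scaled kinetic energy is close to T₁ c² / 2. This first bounds |ν| from
above; then η + qν is small, so nearly all the energy is radial and |ν| is bounded below. -/
theorem exists_radialVel_bounds (C E : ℝ) : ∃ ε > 0, ∀ x ∈ p.energyLevel C E,
    x (Sum.inl 0) < ε → |slope x| < ε → |p.slopeVel x| < ε → p.radialVel x < 0 →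
      -(2 * p.collapseSpeed) ≤ p.radialVel x ∧ p.radialVel x ≤ -p.collapseSpeed / 2 := by
  have hc := p.collapseSpeed_pos
  have hT₁ := p.T₁_pos
  have hT₂ := p.T₂_pos
  set c := p.collapseSpeed
  have hev : ∀ᶠ y : ℝ × ℝ in 𝓝 (0, 0),
      |p.scaledKinetic C E y.1 y.2 - p.T₁ * c ^ 2 / 2| < p.T₁ * c ^ 2 / 8 := by
    have h1 := (p.continuous_scaledKinetic C E).tendsto (0, 0)
    simp only [scaledKinetic_zero] at h1
    exact (Metric.tendsto_nhds.1 h1 _ (by positivity : 0 < p.T₁ * c ^ 2 / 8))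
  obtain ⟨ε₁, hε₁, h₁⟩ := Metric.eventually_nhds_iff.1 hev
  have hev2 : ∀ᶠ e : ℝ in 𝓝 0, p.T₂ * (e * (1 + 2 * c)) ^ 2 / 2 < p.T₁ * c ^ 2 / 8 := by
    have hcont : Continuous fun e : ℝ => p.T₂ * (e * (1 + 2 * c)) ^ 2 / 2 := by fun_prop
    have h1 := hcont.tendsto 0
    simp only [zero_mul, ne_eq, OfNat.ofNat_ne_zero, not_false_eq_true, zero_pow, mul_zero,
      zero_div] at h1
    exact h1.eventually (gt_mem_nhds (by positivity))
  obtain ⟨ε₂, hε₂, h₂⟩ := Metric.eventually_nhds_iff.1 hev2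
  refine ⟨min ε₁ (ε₂ / 2), by positivity, fun x hx hR hq hη hν => ?_⟩
  have hR0 : 0 < x (Sum.inl 0) := hx.1
  have hk := p.scaledKinetic_eq hx
  have hΦ := h₁ (y := (slope x, x (Sum.inl 0))) (by
    rw [Prod.dist_eq, max_lt_iff]
    simp only [dist_zero_right, Real.norm_eq_abs, abs_of_pos hR0]
    exact ⟨hq.trans_le (min_le_left _ _), hR.trans_le (min_le_left _ _)⟩)
  simp only [← hk] at hΦ
  have hΦ1 := (abs_lt.1 hΦ).1
  have hΦ2 := (abs_lt.1 hΦ).2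
  have a2 : 0 ≤ p.T₂ * (p.slopeVel x + slope x * p.radialVel x) ^ 2 / 2 := by positivity
  have hν1 : p.radialVel x ^ 2 ≤ (2 * c) ^ 2 := by
    have : p.T₁ * p.radialVel x ^ 2 ≤ p.T₁ * (2 * c) ^ 2 := by nlinarith [mul_pos hT₁ (pow_pos hc 2)]
    exact le_of_mul_le_mul_left this hT₁
  have hν2 := abs_le_of_sq_le_sq' hν1 (by positivity)
  refine ⟨hν2.1, ?_⟩
  have hh : |p.slopeVel x + slope x * p.radialVel x| ≤ ε₂ / 2 * (1 + 2 * c) := by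
    have h3 : |p.radialVel x| ≤ 2 * c := abs_le.2 hν2
    have h4 := abs_add_le (p.slopeVel x) (slope x * p.radialVel x)
    have h5 : |slope x * p.radialVel x| ≤ ε₂ / 2 * (2 * c) := by
      rw [abs_mul]
      exact mul_le_mul (hq.le.trans (min_le_right _ _)) h3 (abs_nonneg _) (by positivity)
    have h6 := hη.le.trans (min_le_right _ _)
    linarith
  have h7 : p.T₂ * (p.slopeVel x + slope x * p.radialVel x) ^ 2 / 2
      ≤ p.T₂ * (ε₂ / 2 * (1 + 2 * c)) ^ 2 / 2 := by
    rw [← sq_abs (p.slopeVel x + slope x * p.radialVel x)]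
    gcongr
  have h8 := h₂ (y := ε₂ / 2) (by
    rw [dist_zero_right, Real.norm_eq_abs, abs_of_pos (by positivity)]; linarith)
  have h9 : (c / 2) ^ 2 ≤ p.radialVel x ^ 2 := by
    have : p.T₁ * (c / 2) ^ 2 ≤ p.T₁ * p.radialVel x ^ 2 := by nlinarith [mul_pos hT₁ (pow_pos hc 2)]
    exact le_of_mul_le_mul_left this hT₁
  nlinarith

theorem exists_stiffness_bound (C : ℝ) {d : ℝ} (hd : 0 < d) : ∃ ε > 0, ∀ x : Phase 2,
    0 < x (Sum.inl 0) → x (Sum.inl 0) < ε → |slope x| < ε →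
      |p.stiffness C (slope x) (x (Sum.inl 0)) - p.stiffness C 0 0| < d := by
  have h1 := (p.continuous_stiffness C).tendsto (0, 0)
  obtain ⟨ε, hε, h⟩ := Metric.eventually_nhds_iff.1 (Metric.tendsto_nhds.1 h1 d hd)
  refine ⟨ε, hε, fun x hx hR hq => ?_⟩
  refine h (y := (slope x, x (Sum.inl 0))) ?_
  rw [Prod.dist_eq, max_lt_iff]
  simp only [dist_zero_right, Real.norm_eq_abs, abs_of_pos hx]
  exact ⟨hq, hR⟩

theorem isCompact_box (lo hi : Fin 2 ⊕ Fin 2 → ℝ) :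
    IsCompact {x : Phase 2 | ∀ i, x i ∈ Icc (lo i) (hi i)} := by
  have h : IsCompact (WithLp.toLp 2 '' Icc lo hi : Set (Phase 2)) :=
    isCompact_Icc.image (PiLp.continuous_toLp 2 _)
  refine h.of_isClosed_subset ?_ fun x hx => ⟨x.ofLp, ⟨fun i => (hx i).1, fun i => (hx i).2⟩, rfl⟩
  simp only [ofPred_forall]
  exact isClosed_iInter fun i => isClosed_Icc.preimage (by fun_prop)

theorem R_mul_sqrt_mul_P (x : Phase 2) :
    √(x (Sum.inl 0)) * x (Sum.inl 0) * x (Sum.inr 0) = p.T₁ * p.radialVel x := by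
  have := p.T₁_pos
  rw [radialVel]; field_simp

theorem R_mul_sqrt_mul_Q {x : Phase 2} (hx : 0 < x (Sum.inl 0)) :
    √(x (Sum.inl 0)) * x (Sum.inl 0) * x (Sum.inr 1)
      = p.T₂ * (p.slopeVel x + slope x * p.radialVel x) := by
  have := p.T₁_pos
  have := p.T₂_pos
  simp only [slopeVel, slope, radialVel]; field_simp; ring

/-- Motions starting near the planar collapse end in a planar triple collision. -/
theorem exists_trap (hB : 1 + p.B / (16 * p.B₁) < p.μ) (C E : ℝ) :
    ∃ ε > 0, ∀ x ∈ p.energyLevel C E, x (Sum.inl 0) < ε → |slope x| < ε → |p.slopeVel x| < ε →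
      p.radialVel x < 0 → x ∈ p.planarCollisionSet C E := by
  have hc := p.collapseSpeed_pos
  have hk := p.stiffness_zero_pos hB C
  have hT₁ := p.T₁_pos
  have hT₂ := p.T₂_pos
  obtain ⟨ε₁, hε₁, hvel⟩ := p.exists_radialVel_bounds C E
  set c := p.collapseSpeed
  set k := p.stiffness C 0 0
  obtain ⟨δ, hδ0, hδ1, hδ2, hδ3⟩ : ∃ δ : ℝ, 0 < δ ∧ δ ≤ c / 8 ∧ δ ≤ k / (64 * c) ∧ δ ^ 2 ≤ k / 4 := by
    refine ⟨min (min (c / 8) (k / (64 * c))) (√(k / 4)), by positivity,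
      (min_le_left _ _).trans (min_le_left _ _), (min_le_left _ _).trans (min_le_right _ _), ?_⟩
    refine (pow_le_pow_left₀ (by positivity) (min_le_right _ _) 2).trans ?_
    rw [Real.sq_sqrt (by positivity)]
  obtain ⟨ε₂, hε₂, hstiff⟩ := p.exists_stiffness_bound C (d := min (δ * c) (k / 2)) (by positivity)
  set e := min ε₁ ε₂
  have he : 0 < e := by positivity
  set lam := min (c / 16) (δ / 4)
  have hlam : 0 < lam := by positivity
  -- Chosen so that the sublevel set L < ℓ lies in the box |q| < e, |η| < e.
  set ℓ := e ^ 2 * min 1 k / 4 with hℓ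
  have hℓ0 : 0 < ℓ := by positivity
  set L : Phase 2 → ℝ := fun x => lyapunov δ k (slope x) (p.slopeVel x) with hL
  have hL0 : ∀ x, 0 ≤ L x := fun x =>
    le_trans (by positivity) (le_lyapunov hk hδ3 (slope x) (p.slopeVel x))
  have hsmall : ∀ x, L x < ℓ → |slope x| < e ∧ |p.slopeVel x| < e := fun x hx => by
    have h1 := (le_lyapunov hk hδ3 (slope x) (p.slopeVel x)).trans_lt hx
    have h2 : e ^ 2 * min 1 k ≤ e ^ 2 * 1 := by gcongr; exact min_le_left _ _
    have h3 : e ^ 2 * min 1 k ≤ e ^ 2 * k := by gcongr; exact min_le_right _ _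
    constructor
    · refine abs_lt_of_sq_lt_sq ?_ he.le
      have : k * slope x ^ 2 < k * e ^ 2 := by nlinarith [sq_nonneg (p.slopeVel x)]
      exact lt_of_mul_lt_mul_left this hk.le
    · refine abs_lt_of_sq_lt_sq ?_ he.le
      nlinarith [mul_nonneg hk.le (sq_nonneg (slope x))]
  set L' : Phase 2 → ℝ := fun x =>
    (p.slopeVel x * (p.radialVel x * p.slopeVel x / 2
        - slope x * p.stiffness C (slope x) (x (Sum.inl 0)))
      + δ * (p.slopeVel x * p.slopeVel x + slope x * (p.radialVel x * p.slopeVel x / 2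
        - slope x * p.stiffness C (slope x) (x (Sum.inl 0))))
      + k * slope x * p.slopeVel x) with hL'
  have hreg : ∀ x ∈ p.energyLevel C E, x (Sum.inl 0) < e → L x < ℓ → p.radialVel x < 0 →
      -(2 * c) ≤ p.radialVel x ∧ p.radialVel x ≤ -c / 2 ∧ L' x ≤ -lam * L x := by
    intro x hx hR hLx hν
    obtain ⟨hq, hη⟩ := hsmall x hLx
    obtain ⟨h1, h2⟩ := hvel x hx (hR.trans_le (min_le_left _ _)) (hq.trans_le (min_le_left _ _))
      (hη.trans_le (min_le_left _ _)) hν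
    have h3 := hstiff x hx.1 (hR.trans_le (min_le_right _ _)) (hq.trans_le (min_le_right _ _))
    refine ⟨h1, h2, lyapunov_deriv_le hk hc hδ0 hδ1 hδ2 hδ3 h1 h2
      (h3.le.trans (min_le_left _ _)) ?_ _ _⟩
    have h4 := (abs_le.1 (h3.le.trans (min_le_right _ _))).1
    linarith
  have hdL : ∀ {γ : ℝ → Phase 2} {b : ℝ}, p.IsMotion C γ b → ∀ t ∈ Ico 0 b,
      HasDerivWithinAt (fun s => L (γ s)) (L' (γ t) / timeScale (γ t)) (Ico 0 b) t := by
    intro γ b hm t ht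
    have d1 := hm.hasDerivWithinAt_slope ht
    have d2 := hm.hasDerivWithinAt_slopeVel ht
    refine ((((d2.pow 2).div_const 2).add ((d1.const_mul δ).mul d2)).add
      (((d1.pow 2).const_mul k).div_const 2)).congr_deriv ?_
    have := timeScale_pos (hm.2 t ht)
    simp only [hL', Nat.cast_ofNat]
    field_simp
    ring
  have hstay : ∀ {γ : ℝ → Phase 2} {b : ℝ}, p.IsMotion C γ b → γ 0 ∈ p.energyLevel C E →
      γ 0 (Sum.inl 0) < e → L (γ 0) < ℓ → p.radialVel (γ 0) < 0 → ∀ t ∈ Ico 0 b,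
      γ t (Sum.inl 0) < e ∧ L (γ t) < ℓ ∧ p.radialVel (γ t) < 0 := by
    intro γ b hm h0 hR hLx hν
    refine forall_mem_region (c := c / 2) (by positivity) (fun t ht => hm.hasDerivWithinAt_R' ht)
      (hdL hm) (fun t ht => ?_) (fun t ht h1 h2 h3 => ?_) hR hLx hν
    · have hR := (hm.hasDerivWithinAt_R ht).continuousWithinAt
      have hP := (hm.hasDerivWithinAt_P ht).continuousWithinAt
      exact (hR.sqrt.mul hR).mul (hP.div_const _)
    · obtain ⟨k1, k2, k3⟩ := hreg (γ t) (hm.mem_energyLevel h0 ht) h1 h2 h3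
      have hR := hm.2 t ht
      have hts := timeScale_pos hR
      refine ⟨by linarith, ?_, ?_⟩
      · exact div_nonpos_of_nonpos_of_nonneg (mul_nonpos_of_nonpos_of_nonneg h3.le hR.le) hts.le
      · exact div_nonpos_of_nonpos_of_nonneg
          (k3.trans (by nlinarith [mul_nonneg hlam.le (hL0 (γ t))])) hts.le
  -- The positive time scale R^{5/2} has derivative 5ν/2 ≤ −5c/4 in the region, so a motion there
  -- has bounded lifetime.
  have hlife : ∀ {γ : ℝ → Phase 2} {b : ℝ}, p.IsMotion C γ b → γ 0 ∈ p.energyLevel C E →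
      γ 0 (Sum.inl 0) < e → L (γ 0) < ℓ → p.radialVel (γ 0) < 0 →
      b ≤ timeScale (γ 0) / (5 / 4 * c) := by
    intro γ b hm h0 hR hLx hν
    refine le_of_forall_lt_imp_le_of_dense fun t htb => ?_
    rcases lt_or_ge t 0 with ht0 | ht0
    · exact ht0.le.trans (div_nonneg (by unfold timeScale; positivity) (by positivity))
    have ht : t ∈ Ico 0 b := ⟨ht0, htb⟩
    have hanti : AntitoneOn (fun s => timeScale (γ s) + 5 / 4 * c * s) (Ico 0 b) := by
      refine antitoneOn_of_hasDerivWithinAt_nonpos (convex_Ico 0 b)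
        (f' := fun s => 5 / 2 * p.radialVel (γ s) + 5 / 4 * c) (fun s hs =>
          ((hm.hasDerivWithinAt_timeScale hs).continuousWithinAt.add (by fun_prop)))
        (fun s hs => ?_) (fun s hs => ?_)
      · exact (((hm.hasDerivWithinAt_timeScale (interior_subset hs)).add
          ((hasDerivWithinAt_id s _).const_mul (5 / 4 * c))).mono interior_subset).congr_deriv
          (by simp)
      · obtain ⟨h1, h2, h3⟩ := hstay hm h0 hR hLx hν s (interior_subset hs)
        have := (hreg (γ s) (hm.mem_energyLevel h0 (interior_subset hs)) h1 h2 h3).2.1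
        linarith
    have h1 := hanti ⟨le_rfl, ht.1.trans_lt ht.2⟩ ht ht0
    have h2 := timeScale_pos (hm.2 t ht)
    rw [le_div_iff₀ (by positivity)]
    simp only [mul_zero, add_zero] at h1
    linarith
  obtain ⟨ε, hε, hεL⟩ : ∃ ε > 0, ∀ q η : ℝ, |q| < ε → |η| < ε → lyapunov δ k q η < ℓ := by
    refine ⟨√(ℓ / (1 + k)), Real.sqrt_pos.2 (by positivity), fun q η hq hη => ?_⟩
    have h1 := (Real.lt_sqrt (abs_nonneg q)).1 hq
    have h2 := (Real.lt_sqrt (abs_nonneg η)).1 hη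
    rw [sq_abs, lt_div_iff₀ (by positivity)] at h1 h2
    refine (lyapunov_le hk hδ3 q η).trans_lt ?_
    nlinarith
  refine ⟨min e ε, by positivity, fun x hx hR hq hη hν => ?_⟩
  have hRe : x (Sum.inl 0) < e := hR.trans_le (min_le_left _ _)
  have hLx : L x < ℓ := hεL _ _ (hq.trans_le (min_le_right _ _)) (hη.trans_le (min_le_right _ _))
  obtain ⟨γ, t₁, ht₁, h0, hγ, hγU, hK⟩ := exists_maximal_isIntegralCurveOn isOpen_R_pos
    (p.contDiffOn_field C) (x := x) hx.1 (T := timeScale x / (5 / 4 * c)) (by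
      intro γ b hb h0 h1 h2
      have hm : p.IsMotion C γ b := p.isMotion_iff.2 ⟨h1, h2⟩
      subst h0
      exact hlife hm hx hRe hLx hν)
  have hm : p.IsMotion C γ t₁ := p.isMotion_iff.2 ⟨hγ, hγU⟩
  subst h0
  have hin := hstay hm hx hRe hLx hν
  have hin' := fun t ht => hreg (γ t) (hm.mem_energyLevel hx ht) (hin t ht).1 (hin t ht).2.1
    (hin t ht).2.2
  have hRanti : AntitoneOn (fun s => γ s (Sum.inl 0)) (Ico 0 t₁) := by
    refine antitoneOn_of_hasDerivWithinAt_nonpos (convex_Ico 0 t₁)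
      (fun s hs => (hm.hasDerivWithinAt_R' hs).continuousWithinAt)
      (fun s hs => (hm.hasDerivWithinAt_R' (interior_subset hs)).mono interior_subset)
      (fun s hs => ?_)
    have hs := interior_subset hs
    exact div_nonpos_of_nonpos_of_nonneg (mul_nonpos_of_nonpos_of_nonneg (hin s hs).2.2.le
      (hm.2 s hs).le) (timeScale_pos (hm.2 s hs)).le
  have hR0 : Tendsto (fun t => γ t (Sum.inl 0)) (𝓝[<] t₁) (𝓝 0) := by
    rw [Metric.tendsto_nhds]
    intro d hd
    -- If R stayed above d, the bounds on q, ν and η would confine the maximal motion to a compact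
    -- box in {R > 0}.
    obtain ⟨t, ht, htd⟩ : ∃ t ∈ Ico 0 t₁, γ t (Sum.inl 0) < d := by
      by_contra! hge
      set m := √d * d
      have hm0 : 0 < m := mul_pos (Real.sqrt_pos.2 hd) hd
      have hmul : ∀ {a b B : ℝ}, m ≤ a → |a * b| ≤ B → |b| ≤ B / m := by
        intro a b B ha hb
        rw [le_div_iff₀ hm0]
        rw [abs_mul, abs_of_pos (hm0.trans_le ha)] at hb
        nlinarith [abs_nonneg b]
      set lo : Fin 2 ⊕ Fin 2 → ℝ := Sum.elim ![d, -(e * e)]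
        ![-(p.T₁ * (2 * c) / m), -(p.T₂ * (e + e * (2 * c)) / m)]
      set hi : Fin 2 ⊕ Fin 2 → ℝ := Sum.elim ![e, e * e]
        ![p.T₁ * (2 * c) / m, p.T₂ * (e + e * (2 * c)) / m]
      refine hK {x | ∀ i, x i ∈ Icc (lo i) (hi i)} (isCompact_box lo hi)
        (fun x hx => hd.trans_le (hx (Sum.inl 0)).1) fun t ht => ?_
      obtain ⟨h1, h2, h3⟩ := hin t ht
      obtain ⟨k1, k2, -⟩ := hin' t ht
      obtain ⟨hq, hη⟩ := hsmall _ h2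
      have hRt : 0 < γ t (Sum.inl 0) := hm.2 t ht
      have hdR := hge t ht
      have hmR : m ≤ √(γ t (Sum.inl 0)) * γ t (Sum.inl 0) :=
        mul_le_mul (Real.sqrt_le_sqrt hdR) hdR hd.le (Real.sqrt_nonneg _)
      have hν : |p.radialVel (γ t)| ≤ 2 * c := abs_le.2 ⟨k1, by linarith⟩
      have hz : |γ t (Sum.inl 1)| ≤ e * e := by
        have : γ t (Sum.inl 1) = slope (γ t) * γ t (Sum.inl 0) := by rw [slope]; field_simp
        rw [this, abs_mul, abs_of_pos hRt]
        exact mul_le_mul hq.le h1.le hRt.le he.le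
      have hP : |γ t (Sum.inr 0)| ≤ p.T₁ * (2 * c) / m := by
        refine hmul hmR ?_
        rw [R_mul_sqrt_mul_P, abs_mul, abs_of_pos hT₁]
        gcongr
      have hQ : |γ t (Sum.inr 1)| ≤ p.T₂ * (e + e * (2 * c)) / m := by
        refine hmul hmR ?_
        rw [R_mul_sqrt_mul_Q p hRt, abs_mul, abs_of_pos hT₂]
        gcongr
        refine (abs_add_le _ _).trans (add_le_add hη.le ?_)
        rw [abs_mul]
        exact mul_le_mul hq.le hν (abs_nonneg _) he.le
      intro i
      rcases i with i | i <;> fin_cases i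
      · exact ⟨hdR, h1.le⟩
      · exact abs_le.1 hz
      · exact abs_le.1 hP
      · exact abs_le.1 hQ
    filter_upwards [Ioo_mem_nhdsLT ht.2] with s hs
    have hs' : s ∈ Ico 0 t₁ := ⟨ht.1.trans hs.1.le, hs.2⟩
    rw [dist_zero_right, Real.norm_eq_abs, abs_of_pos (hm.2 s hs')]
    exact (hRanti ht hs' hs.1.le).trans_lt htd
  refine ⟨hx, γ, t₁, ht₁, rfl, hm, hR0, ?_⟩
  -- In scaled time L' ≤ −lam L, while R decays at rate at most 2c. With this exponent L R^{-a} does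
  -- not increase, so L ≤ const · R^a → 0.
  set a := lam / (2 * c) with ha
  have ha0 : 0 < a := by positivity
  have hFanti : AntitoneOn (fun s => L (γ s) * γ s (Sum.inl 0) ^ (-a)) (Ico 0 t₁) := by
    have hd : ∀ s ∈ Ico 0 t₁, HasDerivWithinAt (fun s => L (γ s) * γ s (Sum.inl 0) ^ (-a))
        (γ s (Sum.inl 0) ^ (-a) / timeScale (γ s) * (L' (γ s) - a * L (γ s) * p.radialVel (γ s)))
        (Ico 0 t₁) s := fun s hs => by
      have hRs := hm.2 s hs
      have hts := timeScale_pos hRs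
      refine ((hdL hm s hs).mul ((hm.hasDerivWithinAt_R' hs).rpow_const
        (Or.inl hRs.ne'))).congr_deriv ?_
      rw [Real.rpow_sub_one hRs.ne']
      field_simp
      ring
    refine antitoneOn_of_hasDerivWithinAt_nonpos (convex_Ico 0 t₁)
      (fun s hs => (hd s hs).continuousWithinAt)
      (fun s hs => (hd s (interior_subset hs)).mono interior_subset) (fun s hs => ?_)
    have hs := interior_subset hs
    obtain ⟨k1, -, k3⟩ := hin' s hs
    have hRs := hm.2 s hs
    have hts := timeScale_pos hRs
    refine mul_nonpos_of_nonneg_of_nonpos (by positivity) ?_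
    have h1 : -(a * L (γ s) * p.radialVel (γ s)) ≤ a * L (γ s) * (2 * c) := by
      nlinarith [mul_nonneg ha0.le (hL0 (γ s))]
    have h2 : a * L (γ s) * (2 * c) = lam * L (γ s) := by rw [ha]; field_simp
    linarith
  have hLlim : Tendsto (fun t => 4 / k * (L (γ 0) * γ 0 (Sum.inl 0) ^ (-a) *
      γ t (Sum.inl 0) ^ a)) (𝓝[<] t₁) (𝓝 0) := by
    have h1 : Tendsto (fun t => γ t (Sum.inl 0) ^ a) (𝓝[<] t₁) (𝓝 (0 ^ a)) :=
      hR0.rpow_const (Or.inr ha0.le)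
    rw [Real.zero_rpow ha0.ne'] at h1
    simpa using (h1.const_mul (L (γ 0) * γ 0 (Sum.inl 0) ^ (-a))).const_mul (4 / k)
  have hsq : Tendsto (fun t => slope (γ t) ^ 2) (𝓝[<] t₁) (𝓝 0) := by
    refine squeeze_zero' (Eventually.of_forall fun t => sq_nonneg _) ?_ hLlim
    filter_upwards [Ioo_mem_nhdsLT ht₁] with t ht
    have ht' : t ∈ Ico 0 t₁ := ⟨ht.1.le, ht.2⟩
    have hRt := hm.2 t ht'
    have h1 := hFanti ⟨le_rfl, ht₁⟩ ht' ht.1.le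
    have h2 := le_lyapunov hk hδ3 (slope (γ t)) (p.slopeVel (γ t))
    have hpow := Real.rpow_pos_of_pos hRt a
    have h3 : L (γ t) ≤ L (γ 0) * γ 0 (Sum.inl 0) ^ (-a) * γ t (Sum.inl 0) ^ a := by
      simp only [Real.rpow_neg hRt.le a] at h1
      rwa [← div_eq_mul_inv, div_le_iff₀ hpow] at h1
    have h4 : slope (γ t) ^ 2 ≤ 4 / k * L (γ t) := by
      have : L (γ t) = lyapunov δ k (slope (γ t)) (p.slopeVel (γ t)) := rfl
      rw [div_mul_eq_mul_div, le_div_iff₀ hk]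
      nlinarith [sq_nonneg (p.slopeVel (γ t))]
    exact h4.trans (by gcongr)
  have := hsq.sqrt
  simp only [Real.sqrt_sq_eq_abs, Real.sqrt_zero] at this
  exact (tendsto_zero_iff_abs_tendsto_zero _).2 this

end Params

/-! ### Openness and measure -/

theorem euclideanHausdorffMeasure_image_le {X Y : Type*} [EMetricSpace X] [MeasurableSpace X]
    [BorelSpace X] [EMetricSpace Y] [MeasurableSpace Y] [BorelSpace Y] {f : X → Y}
    (hf : LipschitzWith 1 f) (d : ℕ) (s : Set X) : μHE[d] (f '' s) ≤ μHE[d] s := by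
  have h := hf.hausdorffMeasure_image_le (d := (d : ℝ)) (by positivity) s
  rw [ENNReal.coe_one, ENNReal.one_rpow, one_mul] at h
  rw [Measure.euclideanHausdorffMeasure_def, Measure.euclideanHausdorffMeasure_def,
    Measure.smul_apply, Measure.smul_apply]
  gcongr

/-- The projection `(R, z, P_R, P_z) ↦ (R, z, P_z)`. -/
noncomputable def forgetP (x : Phase 2) : EuclideanSpace ℝ (Fin 3) :=
  !₂[x (Sum.inl 0), x (Sum.inl 1), x (Sum.inr 1)]

theorem lipschitzWith_forgetP : LipschitzWith 1 forgetP := by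
  refine LipschitzWith.of_dist_le_mul fun x y => ?_
  rw [NNReal.coe_one, one_mul, EuclideanSpace.dist_eq, EuclideanSpace.dist_eq]
  refine Real.sqrt_le_sqrt ?_
  simp only [Fin.sum_univ_three, Fintype.sum_sum_type, Fin.sum_univ_two, forgetP]
  simp only [Matrix.cons_val]
  linarith [sq_nonneg (dist (x (Sum.inr 0)) (y (Sum.inr 0)))]

namespace Params

variable (p : Params)

theorem measurable_reducedHamiltonian (C : ℝ) : Measurable (p.reducedHamiltonian C) := by
  unfold reducedHamiltonian potential
  fun_prop

theorem measurableSet_energyLevel (C E : ℝ) : MeasurableSet (p.energyLevel C E) :=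
  isOpen_R_pos.measurableSet.inter (p.measurable_reducedHamiltonian C (measurableSet_singleton E))

/-- The phase points near the planar collapse. -/
def collapseNhd (ε : ℝ) : Set (Phase 2) :=
  {x | 0 < x (Sum.inl 0) ∧ x (Sum.inl 0) < ε ∧ |slope x| < ε ∧ |p.slopeVel x| < ε ∧
    p.radialVel x < 0}

theorem collapseNhd_mem_nhds {ε : ℝ} {x : Phase 2} (hx : x ∈ p.collapseNhd ε) :
    p.collapseNhd ε ∈ 𝓝 x := by
  obtain ⟨h1, h2, h3, h4, h5⟩ := hx
  have c0 : ∀ i, ContinuousAt (fun y : Phase 2 => y i) x := fun i => by fun_prop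
  have c1 : ContinuousAt slope x := (c0 (Sum.inl 1)).div (c0 (Sum.inl 0)) h1.ne'
  have c2 : ContinuousAt p.slopeVel x := by unfold slopeVel; fun_prop
  have c3 : ContinuousAt p.radialVel x := by unfold radialVel; fun_prop
  exact ((c0 (Sum.inl 0)).eventually (lt_mem_nhds h1)).and
    (((c0 (Sum.inl 0)).eventually (gt_mem_nhds h2)).and
    ((c1.abs.eventually (gt_mem_nhds h3)).and ((c2.abs.eventually (gt_mem_nhds h4)).and
      (c3.eventually (gt_mem_nhds h5)))))

theorem exists_collapseNhd (hB : 1 + p.B / (16 * p.B₁) < p.μ) (C E : ℝ) :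
    ∃ ε > 0, p.energyLevel C E ∩ p.collapseNhd ε ⊆ p.planarCollisionSet C E := by
  obtain ⟨ε, hε, h⟩ := p.exists_trap hB C E
  exact ⟨ε, hε, fun x ⟨hx, _, h1, h2, h3, h4⟩ => h x hx h1 h2 h3 h4⟩

/-- A planar collision orbit is inside the trap at some t₀ < t₁, because q and η tend to 0 and ν to
−c. Nearby orbits are there at t₀ too, and are continued by the trapped motion. -/
theorem eventually_mem_planarCollisionSet (hB : 1 + p.B / (16 * p.B₁) < p.μ) {C E : ℝ}
    {x : Phase 2} (hx : x ∈ p.planarCollisionSet C E) :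
    ∀ᶠ y in 𝓝 x, y ∈ p.energyLevel C E → y ∈ p.planarCollisionSet C E := by
  obtain ⟨ε, hε, hsub⟩ := p.exists_collapseNhd hB C E
  obtain ⟨hxE, γ, t₁, ht₁, rfl, hm, hcol⟩ := hx
  have hη := hm.tendsto_slopeVel ht₁ hxE hcol
  have hν := hm.tendsto_radialVel ht₁ hxE hcol
  have hc := p.collapseSpeed_pos
  have hq := hcol.2.abs
  have hη := hη.abs
  rw [abs_zero] at hq hη
  obtain ⟨t₀, ht₀, h1, h2, h3, h4⟩ := (Filter.Eventually.and (Ioo_mem_nhdsLT ht₁ : ∀ᶠ t in 𝓝[<] t₁, t ∈ Ioo 0 t₁)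
    ((hcol.1.eventually (gt_mem_nhds hε)).and ((hq.eventually (gt_mem_nhds hε)).and
    ((hη.eventually (gt_mem_nhds hε)).and
      (hν.eventually (gt_mem_nhds (show -p.collapseSpeed < 0 by linarith))))))).exists
  have ht₀' : t₀ ∈ Ico 0 t₁ := ⟨ht₀.1.le, ht₀.2⟩
  obtain ⟨hγ, hγU⟩ := p.isMotion_iff.1 hm
  have hN := p.collapseNhd_mem_nhds (ε := ε) ⟨hm.2 t₀ ht₀', h1, h2, h3, h4⟩
  filter_upwards [eventually_exists_isIntegralCurveOn_Icc isOpen_R_pos (p.contDiffOn_field C)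
    hγ hγU ht₀' hN] with y hy hyE
  obtain ⟨γ₁, rfl, hγ₁, hm₁, hγ₁N⟩ := hy
  -- the energy is conserved along `γ₁`
  have hE : γ₁ t₀ ∈ p.energyLevel C E := by
    have hmot : p.IsMotion C γ₁ t₀ := p.isMotion_iff.2
      ⟨hγ₁.mono Ico_subset_Icc_self, hm₁.mono_left Ico_subset_Icc_self⟩
    have hmem : t₀ ∈ Icc 0 t₀ := right_mem_Icc.2 ht₀.1.le
    refine ⟨hm₁ hmem, ?_⟩
    -- Conservation is available on [0, t₀) only; continuity carries it to the endpoint t₀.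
    have hcont : ContinuousWithinAt (p.reducedHamiltonian C ∘ γ₁) (Ico 0 t₀) t₀ :=
      ((p.differentiableAt_reducedHamiltonian C (hm₁ hmem)).continuousAt.comp_continuousWithinAt
        (hγ₁.continuousOn t₀ hmem)).mono Ico_subset_Icc_self
    have hne : (𝓝[Ico 0 t₀] t₀).NeBot := by
      rw [← mem_closure_iff_nhdsWithin_neBot, closure_Ico ht₀.1.ne]
      exact hmem
    refine tendsto_nhds_unique hcont (tendsto_const_nhds.congr' ?_)
    filter_upwards [self_mem_nhdsWithin] with s hs
    exact (hmot.mem_energyLevel hyE hs).2.symm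
  obtain ⟨-, γ₂, t₂, ht₂, h0, hm₂, hcol₂⟩ := hsub ⟨hE, hγ₁N⟩
  obtain ⟨hγ₂, hγ₂U⟩ := p.isMotion_iff.1 hm₂
  have hev : ∀ᶠ t in 𝓝[<] (t₀ + t₂), ¬ t ≤ t₀ := by
    filter_upwards [Ioo_mem_nhdsLT (show t₀ < t₀ + t₂ by linarith)] with t ht using not_le.2 ht.1
  have hsub' : Tendsto (fun t => t - t₀) (𝓝[<] (t₀ + t₂)) (𝓝[<] t₂) := by
    refine tendsto_nhdsWithin_iff.2 ⟨?_, ?_⟩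
    · have : Tendsto (fun t => t - t₀) (𝓝 (t₀ + t₂)) (𝓝 (t₀ + t₂ - t₀)) :=
        tendsto_id.sub tendsto_const_nhds
      rw [add_sub_cancel_left] at this
      exact this.mono_left nhdsWithin_le_nhds
    · filter_upwards [self_mem_nhdsWithin] with t ht
      have ht : t < t₀ + t₂ := ht
      show t - t₀ < t₂
      linarith
  refine ⟨hyE, fun t => if t ≤ t₀ then γ₁ t else γ₂ (t - t₀), t₀ + t₂, by linarith [ht₀.1],
    if_pos ht₀.1.le, p.isMotion_iff.2 ⟨IsIntegralCurveOn.concat ht₀.1.le hγ₁ hγ₂ h0,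
      fun t ht => ?_⟩, ?_, ?_⟩
  · by_cases h : t ≤ t₀
    · simp only [h, if_true]
      exact hm₁ ⟨ht.1, h⟩
    · simp only [h, if_false]
      exact hγ₂U ⟨by linarith, by linarith [ht.2]⟩
  · refine (hcol₂.1.comp hsub').congr' (hev.mono fun t ht => ?_)
    simp [ht]
  · refine (hcol₂.2.comp hsub').congr' (hev.mono fun t ht => ?_)
    simp [ht]

/-- Relative openness writes the set as the measurable energy level intersected with an open set. -/
theorem measurableSet_planarCollisionSet (hB : 1 + p.B / (16 * p.B₁) < p.μ) (C E : ℝ) :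
    MeasurableSet (p.planarCollisionSet C E) := by
  have h : p.planarCollisionSet C E = p.energyLevel C E ∩
      interior {y | y ∈ p.energyLevel C E → y ∈ p.planarCollisionSet C E} := by
    ext x
    exact ⟨fun hx => ⟨hx.1, mem_interior_iff_mem_nhds.2 (p.eventually_mem_planarCollisionSet hB hx)⟩,
      fun hx => interior_subset hx.2 hx.1⟩
  rw [h]
  exact (p.measurableSet_energyLevel C E).inter isOpen_interior.measurableSet

/-! ### Positive measure, by projection of the inward half of the energy level -/

/-- The square of the momentum `P_R` on the energy level `E`, in terms of `(R, z, P_z)`. -/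
noncomputable def momentumSq (C E : ℝ) (y : EuclideanSpace ℝ (Fin 3)) : ℝ :=
  p.M * (E - (2 * p.M + p.m) / (4 * p.M * p.m) * y 2 ^ 2 - p.potential (y 0) (y 1))
    - C ^ 2 / y 0 ^ 2

/-- The point with negative radial momentum on the energy level `E` above `(R, z, P_z)`. -/
noncomputable def inwardPoint (C E : ℝ) (y : EuclideanSpace ℝ (Fin 3)) : Phase 2 :=
  WithLp.toLp 2 (Sum.elim ![y 0, y 1] ![-√(p.momentumSq C E y), y 2])

theorem forgetP_inwardPoint (C E : ℝ) (y : EuclideanSpace ℝ (Fin 3)) :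
    forgetP (p.inwardPoint C E y) = y := by
  ext i
  fin_cases i <;> simp [forgetP, inwardPoint]

theorem inwardPoint_mem_energyLevel {C E : ℝ} {y : EuclideanSpace ℝ (Fin 3)} (h0 : 0 < y 0)
    (h : 0 ≤ p.momentumSq C E y) : p.inwardPoint C E y ∈ p.energyLevel C E := by
  have hM := p.M_pos.ne'
  refine ⟨by simpa [inwardPoint] using h0, ?_⟩
  simp only [reducedHamiltonian, inwardPoint, Sum.elim_inl, Sum.elim_inr, Matrix.cons_val_zero,
    Matrix.cons_val_one, neg_sq, Real.sq_sqrt h]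
  simp only [momentumSq]
  field_simp
  ring

theorem continuousAt_momentumSq (C E : ℝ) {y : EuclideanSpace ℝ (Fin 3)} (h0 : 0 < y 0) :
    ContinuousAt (p.momentumSq C E) y := by
  have h1 := h0.ne'
  have h2 : √(y 0 ^ 2 + 4 * y 1 ^ 2) ≠ 0 := (Real.sqrt_pos.2 (by positivity)).ne'
  unfold momentumSq potential
  fun_prop (disch := first | assumption | (apply pow_ne_zero; assumption))

/-- Shows that for small R every level contains planar points with P_z = 0 and P_R < 0, whatever C
and E are. -/
theorem momentumSq_planar (C E : ℝ) {R : ℝ} (hR : 0 < R) :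
    p.momentumSq C E !₂[R, 0, 0] = p.M * p.scaledKinetic C E 0 R / R ^ 3 := by
  have hM := p.M_pos.ne'
  simp [momentumSq, potential, scaledKinetic, Real.sqrt_sq hR.le]
  field_simp
  ring

theorem euclideanHausdorffMeasure_planarCollisionSet_pos (hB : 1 + p.B / (16 * p.B₁) < p.μ)
    (C E : ℝ) : 0 < μHE[3] (p.planarCollisionSet C E) := by
  obtain ⟨ε, hε, hsub⟩ := p.exists_collapseNhd hB C E
  have hT₁ := p.T₁_pos
  obtain ⟨R, hR, hRε, hk⟩ : ∃ R, 0 < R ∧ R < ε ∧ 0 < p.scaledKinetic C E 0 R := by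
    have hlim : Tendsto (fun R => p.scaledKinetic C E 0 R) (𝓝[>] 0)
        (𝓝 (p.T₁ * p.collapseSpeed ^ 2 / 2)) := by
      rw [← p.scaledKinetic_zero C E]
      exact tendsto_of_continuous_uncurry (p.continuous_scaledKinetic C E) tendsto_const_nhds
        (tendsto_id.mono_left nhdsWithin_le_nhds)
    have hc := p.collapseSpeed_pos
    obtain ⟨R, hR, hk⟩ := (Filter.Eventually.and (Ioo_mem_nhdsGT hε : ∀ᶠ R in 𝓝[>] 0, R ∈ Ioo 0 ε)
      (hlim.eventually (lt_mem_nhds (by positivity)))).exists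
    exact ⟨R, hR.1, hR.2, hk⟩
  set y₀ : EuclideanSpace ℝ (Fin 3) := !₂[R, 0, 0]
  have hy0 : 0 < y₀ 0 := by simpa [y₀] using hR
  have hpos : 0 < p.momentumSq C E y₀ := by
    have := p.M_pos
    rw [momentumSq_planar p C E hR]
    positivity
  have hcm := p.continuousAt_momentumSq C E hy0
  have hcg : ContinuousAt (p.inwardPoint C E) y₀ := by
    refine (PiLp.continuous_toLp 2 _).continuousAt.comp (continuousAt_pi.2 fun i => ?_)
    rcases i with i | i <;> fin_cases i <;> simp
    · fun_prop
    · fun_prop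
    · exact hcm.sqrt.neg
    · fun_prop
  have hmem : p.inwardPoint C E y₀ ∈ p.collapseNhd ε := by
    have hS := Real.sqrt_pos.2 hR
    have hP := Real.sqrt_pos.2 hpos
    refine ⟨by simpa [inwardPoint] using hy0, by simpa [inwardPoint, y₀] using hRε,
      by simpa [inwardPoint, slope, y₀] using hε, by simpa [inwardPoint, slopeVel, y₀] using hε, ?_⟩
    have e : p.radialVel (p.inwardPoint C E y₀) = -(√R * R * (√(p.momentumSq C E y₀) / p.T₁)) := by
      simp only [radialVel, inwardPoint, Sum.elim_inl, Sum.elim_inr, Matrix.cons_val_zero]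
      simp only [y₀, Matrix.cons_val_zero]
      ring
    rw [e, neg_lt_zero]
    positivity
  -- `inwardPoint` is a section of the projection, continuous at y₀, with value at y₀ inside the
  -- trap; so all points near y₀ are projections of trapped points.
  have hnhds : forgetP '' p.planarCollisionSet C E ∈ 𝓝 y₀ := by
    have h0 : ContinuousAt (fun y : EuclideanSpace ℝ (Fin 3) => y 0) y₀ := by fun_prop
    filter_upwards [h0.eventually (lt_mem_nhds hy0), hcm.eventually (lt_mem_nhds hpos),
      hcg.preimage_mem_nhds (p.collapseNhd_mem_nhds hmem)] with y h1 h2 h3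
    exact ⟨p.inwardPoint C E y, hsub ⟨p.inwardPoint_mem_energyLevel h1 h2.le, h3⟩,
      p.forgetP_inwardPoint C E y⟩
  refine lt_of_lt_of_le ?_ (euclideanHausdorffMeasure_image_le lipschitzWith_forgetP 3 _)
  rw [EuclideanSpace.euclideanHausdorffMeasure_eq_volume]
  exact Measure.measure_pos_of_mem_nhds _ hnhds

end Params

end IsoscelesSchwarzschild

/-- On every energy level `h`, at every angular momentum `C`, the set of initial conditions leading
to triple collision with a limiting geometric configuration of a homographic solution is measurable
and has positive three-dimensional Lebesgue measure (`μHE[3]` is the surface measure of the energy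
level), and it consists of the initial conditions whose orbits tend to `Q*`. -/
theorem mainTheorem6 (p : IsoscelesSchwarzschild.Params)
    (hA : 1 + p.A / (4 * p.A₁) < p.μ)
    (hB : 1 + p.B / (16 * p.B₁) < p.μ)
    (hgen : (p.μ - 1) ^ (4 / 15 : ℝ) * (4 * p.A₁ / p.A) ^ (2 / 3 : ℝ)
      ≠ (16 * p.B₁ / p.B) ^ (2 / 5 : ℝ))
    (C h : ℝ) :
    MeasurableSet (p.homographicCollisionSet C h) ∧
    0 < μHE[3] (p.homographicCollisionSet C h) ∧
    p.homographicCollisionSet C h = p.basinQStar C h := by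
  have hμ : 1 < p.μ := by
    have := div_pos p.A_pos (mul_pos four_pos p.A₁_pos)
    linarith
  rw [p.basinQStar_eq, p.homographicCollisionSet_eq hμ hgen]
  exact ⟨p.measurableSet_planarCollisionSet hB C h,
    p.euclideanHausdorffMeasure_planarCollisionSet_pos hB C h, rfl⟩
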